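/- An instance of $\textsc{KnapsackExtendWeak}^+$ consists of a length $L$, a finite set $U\subseteq\{1,\dots,w_{\max}\}$ of weights, for every $w\in U$ a strictly concave function $Q_w\colon\mathbb{Z}_{\ge 0}\to\mathbb{Z}$ (that is, $Q_w(x+2)-Q_w(x+1)<Q_w(x+1)-Q_w(x)$ for all $x\ge 0$) with $Q_w(0)=0$, initial profits $q[0],\dots,q[L-1]\in\mathbb{Z}$, and sets $S[0],\dots,S[L-1]\subseteq U$. For $0\le i\le L-1$, a solution for $i$ is a pair $(z,\vec x)$ with $z\in\{0,\dots,L-1\}$, $\vec x\in\mathbb{Z}_{\ge 0}^{U}$ and $z+\sum_{w\in U}w\,x_w=i$; its profit is $q[z]+\sum_{w\in U}Q_w(x_w)$, and it is a maximizer for $i$ if no solution for $i$ has larger profit. The task is to output, for every $0\le i\le L-1$, a solution $(z[i],\vec x[i])$ for $i$ (with $\vec x[i]$ written sparsely) together with its profit $r[i]$, such that $(z[i],\vec x[i])$ is a maximizer for $i$ whenever all maximizers $(z,\vec x)$ for $i$ satisfy $\operatorname{supp}(\vec x)\subseteq S[z]$. The computation model is a deterministic word RAM with unit-cost arithmetic,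 comparisons and memory accesses on (signed) words, in which $Q_w(k)$ can be evaluated in one step for given $w\in U$ and $k\ge 0$. If all the input integers (namely $L$, the $w\in U$, the $q[i]$, and the values $Q_w(k)$ for $w\in U$ and $k\ge 0$ with $wk<L$) are less than $2^W$ in absolute value, the machine has words of $W+O(1)$ bits. Lemma. There is a single program for this machine that solves every instance of $\textsc{KnapsackExtendWeak}^+$ with $|S[i]|\le 1$ for all $i$ in $O(L\log L)$ time. (The constant in the $O(\cdot)$ is absolute; in particular it does not depend on $W$, $w_{\max}$, $|U|$, or the functions $Q_w$. In the input, $S[i]$ is given by its element, or by $0$ if it is empty.) -/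

import Mathlib

/-! ## A word RAM with an evaluation oracle

Programs of a small deterministic imperative language over signed machine words. The memory
consists of scalar variables and of arrays of words; a program is a finite piece of syntax, so
it mentions finitely many variables and arrays (interleaving the arrays gives a single flat
memory with constant overhead). Every operation, memory access, oracle call and test costs one
step. A run in which some number does not fit in a machine word gets stuck. -/

namespace WordRAM

/-- Expressions. `lt` and `eq` return 1 for true and 0 for false;
`query e f` is one call to the oracle with the two arguments `e`, `f`. -/
inductive Expr where
  | const (n : ℤ)
  | var (x : ℕ)
  | load (a : ℕ) (i : Expr)
  | add (e f : Expr)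
  | sub (e f : Expr)
  | mul (e f : Expr)
  | div (e f : Expr)
  | mod (e f : Expr)
  | lt (e f : Expr)
  | eq (e f : Expr)
  | query (e f : Expr)

/-- Commands: `assign x e` is `x := e`, `store a i e` is `a[i] := e`, `cond e p p₂` runs `p` if
`e` is nonzero and `p₂` otherwise, and `loop e p` repeats `p` as long as `e` is nonzero. -/
inductive Cmd where
  | skip
  | assign (x : ℕ) (e : Expr)
  | store (a : ℕ) (i e : Expr)
  | seq (p p₂ : Cmd)
  | cond (e : Expr) (p p₂ : Cmd)
  | loop (e : Expr) (p : Cmd)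

/-- The contents of the scalar variables and of the arrays. -/
structure State where
  var : ℕ → ℤ
  arr : ℕ → ℕ → ℤ

/-- The answer of the oracle to a pair of words; `none` means that the machine may not ask this. -/
abbrev Oracle := ℤ → ℤ → Option ℤ

/-- The value `v` if it fits in a word of `b` bits and a sign, otherwise stuck. -/
def fit (b : ℕ) (v : ℤ) : Option ℤ := if |v| < 2 ^ b then some v else none

/-- The value of an expression on a machine with word length `b`; `none` if the evaluation gets
stuck: a number that does not fit in a word, a negative array index, a division by zero, or a
call that the oracle does not answer. -/
def Expr.eval (b : ℕ) (O : Oracle) (s : State) : Expr → Option ℤ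
  | .const n => fit b n
  | .var x => some (s.var x)
  | .load a i => (i.eval b O s).bind fun j => if 0 ≤ j then some (s.arr a j.toNat) else none
  | .add e f => (e.eval b O s).bind fun u => (f.eval b O s).bind fun v => fit b (u + v)
  | .sub e f => (e.eval b O s).bind fun u => (f.eval b O s).bind fun v => fit b (u - v)
  | .mul e f => (e.eval b O s).bind fun u => (f.eval b O s).bind fun v => fit b (u * v)
  | .div e f => (e.eval b O s).bind fun u => (f.eval b O s).bind fun v =>
      if v = 0 then none else fit b (u / v)
  | .mod e f => (e.eval b O s).bind fun u => (f.eval b O s).bind fun v =>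
      if v = 0 then none else fit b (u % v)
  | .lt e f => (e.eval b O s).bind fun u => (f.eval b O s).bind fun v =>
      fit b (if u < v then 1 else 0)
  | .eq e f => (e.eval b O s).bind fun u => (f.eval b O s).bind fun v =>
      fit b (if u = v then 1 else 0)
  | .query e f => (e.eval b O s).bind fun u => (f.eval b O s).bind fun v =>
      (O u v).bind fun y => fit b y

/-- The number of steps of the evaluation of an expression: one for each node. -/
def Expr.cost : Expr → ℕ
  | .const _ => 1
  | .var _ => 1
  | .load _ i => i.cost + 1
  | .add e f => e.cost + f.cost + 1
  | .sub e f => e.cost + f.cost + 1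
  | .mul e f => e.cost + f.cost + 1
  | .div e f => e.cost + f.cost + 1
  | .mod e f => e.cost + f.cost + 1
  | .lt e f => e.cost + f.cost + 1
  | .eq e f => e.cost + f.cost + 1
  | .query e f => e.cost + f.cost + 1

/-- `s` with the variable `x` set to `v`. -/
def State.setVar (s : State) (x : ℕ) (v : ℤ) : State :=
  { s with var := Function.update s.var x v }

/-- `s` with the entry `j` of the array `a` set to `v`. -/
def State.setArr (s : State) (a j : ℕ) (v : ℤ) : State :=
  { s with arr := Function.update s.arr a (Function.update (s.arr a) j v) }

/-- `Exec b O p s t r`: on a machine with word length `b` and oracle `O`, the program `p` started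
in the state `s` halts after exactly `t` steps, in the state `r`. -/
inductive Exec (b : ℕ) (O : Oracle) : Cmd → State → ℕ → State → Prop where
  | skip (s : State) : Exec b O .skip s 1 s
  | assign {s : State} {x : ℕ} {e : Expr} {v : ℤ} (he : e.eval b O s = some v) :
      Exec b O (.assign x e) s (e.cost + 1) (s.setVar x v)
  | store {s : State} {a : ℕ} {i e : Expr} {j v : ℤ} (hi : i.eval b O s = some j) (hj : 0 ≤ j)
      (he : e.eval b O s = some v) :
      Exec b O (.store a i e) s (i.cost + e.cost + 1) (s.setArr a j.toNat v)
  | seq {p p₂ : Cmd} {s s₁ s₂ : State} {t t₂ : ℕ} (h : Exec b O p s t s₁)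
      (h₂ : Exec b O p₂ s₁ t₂ s₂) : Exec b O (.seq p p₂) s (t + t₂) s₂
  | cond_true {e : Expr} {p p₂ : Cmd} {s s₁ : State} {t : ℕ} {v : ℤ}
      (he : e.eval b O s = some v) (hv : v ≠ 0) (h : Exec b O p s t s₁) :
      Exec b O (.cond e p p₂) s (e.cost + 1 + t) s₁
  | cond_false {e : Expr} {p p₂ : Cmd} {s s₁ : State} {t : ℕ}
      (he : e.eval b O s = some 0) (h : Exec b O p₂ s t s₁) :
      Exec b O (.cond e p p₂) s (e.cost + 1 + t) s₁
  | loop_true {e : Expr} {p : Cmd} {s s₁ s₂ : State} {t t₂ : ℕ} {v : ℤ}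
      (he : e.eval b O s = some v) (hv : v ≠ 0) (h : Exec b O p s t s₁)
      (h₂ : Exec b O (.loop e p) s₁ t₂ s₂) :
      Exec b O (.loop e p) s (e.cost + 1 + t + t₂) s₂
  | loop_false {e : Expr} {p : Cmd} {s : State} (he : e.eval b O s = some 0) :
      Exec b O (.loop e p) s (e.cost + 1) s

end WordRAM

/-! ## The problem KnapsackExtendWeak⁺ -/

/-- An instance: a set `U ⊆ {1, …, wmax}` of weights, for each `w ∈ U` a strictly concave profit
function `Q w : ℤ_{≥0} → ℤ` vanishing at `0`, initial profits `q[0], …, q[L-1]`, and sets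
`S[0], …, S[L-1] ⊆ U`. (The values of `Q w` for `w ∉ U` play no role.) -/
structure KnapsackExtendWeak where
  L : ℕ
  wmax : ℕ
  U : Finset ℕ
  U_subset : U ⊆ Finset.Icc 1 wmax
  Q : ℕ → ℕ → ℤ
  Q_zero : ∀ w ∈ U, Q w 0 = 0
  Q_concave : ∀ w ∈ U, ∀ x : ℕ, Q w (x + 2) - Q w (x + 1) < Q w (x + 1) - Q w x
  q : Fin L → ℤ
  S : Fin L → Finset ℕ
  S_subset : ∀ i, S i ⊆ U

namespace KnapsackExtendWeak

variable (K : KnapsackExtendWeak)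

/-- `(z, x)` is a solution for the index `i`: `x` is a vector of nonnegative integers indexed by
`U` (extended by zero) with `z + ∑_{w ∈ U} w * x w = i`. Starting points `z` outside
`{0, …, L-1}` have initial profit `-∞` and are not solutions. -/
def IsSolution (i z : Fin K.L) (x : ℕ →₀ ℕ) : Prop :=
  x.support ⊆ K.U ∧ (z : ℕ) + ∑ w ∈ K.U, w * x w = i

/-- The final total profit of a solution. -/
def profit (z : Fin K.L) (x : ℕ →₀ ℕ) : ℤ :=
  K.q z + ∑ w ∈ K.U, K.Q w (x w)

/-- `(z, x)` is a solution for `i` of maximum total profit. -/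
def IsMaximizer (i z : Fin K.L) (x : ℕ →₀ ℕ) : Prop :=
  K.IsSolution i z x ∧
    ∀ (y : Fin K.L) (v : ℕ →₀ ℕ), K.IsSolution i y v → K.profit y v ≤ K.profit z x

/-- The arrays `x`, `z`, `r` solve the instance: each entry is a solution together with its total
profit, and it is a maximizer for every index `i` such that all maximizers `(y, v)` for `i`
satisfy `supp v ⊆ S[y]`. -/
def Solves (x : Fin K.L → ℕ →₀ ℕ) (z : Fin K.L → Fin K.L) (r : Fin K.L → ℤ) : Prop :=
  ∀ i, K.IsSolution i (z i) (x i) ∧ r i = K.profit (z i) (x i) ∧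
    ((∀ (y : Fin K.L) (v : ℕ →₀ ℕ), K.IsMaximizer i y v → v.support ⊆ K.S y) →
      K.IsMaximizer i (z i) (x i))

/-- All input integers have at most `W` bits: the length, the weights, the initial profits, and
the profits `Q w k` of those multiplicities `k` that can occur in a solution. -/
def FitsIn (W : ℕ) : Prop :=
  K.L < 2 ^ W ∧ (∀ w ∈ K.U, w < 2 ^ W) ∧ (∀ i, |K.q i| < 2 ^ W) ∧
    ∀ w ∈ K.U, ∀ k, w * k < K.L → |K.Q w k| < 2 ^ W

/-- Evaluation of the functions `Q w` for `w ∈ U`. -/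
def oracle : WordRAM.Oracle := fun w k =>
  if 0 ≤ w ∧ w.toNat ∈ K.U ∧ 0 ≤ k then some (K.Q w.toNat k.toNat) else none

/-- The input in the memory of the machine, for an instance in which every `S[i]` has at most one
element: variable 0 holds `L`, array 0 holds the initial profits, and array 1 holds at the index
`i` the element of `S[i]`, or `0` if `S[i]` is empty (elements of `S[i]` are positive).
Everything else is zero. -/
def input : WordRAM.State where
  var x := if x = 0 then (K.L : ℤ) else 0
  arr a j :=
    if h : j < K.L then
      if a = 0 then K.q ⟨j, h⟩
      else if a = 1 then ((∑ w ∈ K.S ⟨j, h⟩, w : ℕ) : ℤ)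
      else 0
    else 0

/-- The memory contains arrays `x`, `z`, `r` that solve the instance: `z`, `r` are in the arrays
2 and 3, and the vector `x[i]` is written sparsely as `m • e_w`, with `w` at the index `i` of
array 4 and the multiplicity `m` at the index `i` of array 5 (`m = 0` for the zero vector). -/
def IsOutput (s : WordRAM.State) : Prop :=
  ∃ (x : Fin K.L → ℕ →₀ ℕ) (z : Fin K.L → Fin K.L) (r : Fin K.L → ℤ), K.Solves x z r ∧
    ∀ i : Fin K.L, s.arr 2 i = ((z i : ℕ) : ℤ) ∧ s.arr 3 i = r i ∧
      ∃ w m : ℕ, s.arr 4 i = (w : ℤ) ∧ s.arr 5 i = (m : ℤ) ∧ x i = Finsupp.single w m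

end KnapsackExtendWeak

/-!
A starting point `z` with `S[z] = {w}` is a *source*: it offers the solutions that use `w` alone,
with profit `val z u` at the indices `u ≡ z` modulo `w`. It suffices to find, for every index, the
best of these offers, but only for the indices to which the promise (all maximizers `(y, v)` satisfy
`supp v ⊆ S[y]`) applies. One sweep over the indices does this.

**Exchange argument.** Let the promise apply to `i`, and let the source `y` of weight `w` give a
maximizer for `i` (`Wins y i`). At an index `p` between `y` and `i` in its progression, replace the
part of the solution up to `p` by another solution for `p` that is at least as good and uses `w` no
more often. By concavity the result is again a maximizer for `i` (`Wins.exchange`), so the promise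
applies to it. Hence no source of a different weight can do as well at `p < i`
(`Wins.val_lt_of_weight_ne`), and if the starting point `p` itself does as well, then it is a source
of weight `w` that wins at `i`, too (`Wins.of_val_le_base`). Therefore the sweep may keep, at every
index, only the sources of a single weight, namely that of the best offer there, and pass
them on to the next index of their progression. In this way each index hands over to at most one
other index, and the promise keeps a winner among the sources that survive.

**Sources of the same weight and residue.** By concavity a later source that has caught up with
an earlier one stays ahead (`val_le_val_of_le`). So the sources that can still become best form a
queue, sorted by starting point, in which each one catches up with its predecessor at a certain
time and these times increase (`Link`, `Deque`). The head is the best one at present. A new source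
removes from the back those which it catches up with before they become best, and finds the
time at which it catches up with the last remaining one by binary search (`append_spec`); overtaken
sources are removed from the front (`popFront_spec`). The queues are doubly linked lists. Queues
at different indices are disjoint: a queue waits at the next index of the progression of its
sources, so its weight and residue determine where (`Inv.eq_of_mem`).

**Running time.** The step at an index takes constant time, plus a binary search, plus a constant
for each removal. As each step adds at most one source, the number of sources in the
queues is a potential that pays for the removals (`body_spec`), and the total is `O(L log L)`.

The program is verified by a weakest-precondition calculus for the machine (`WordRAM.wp`) in which
the postcondition also sees the number of steps.
-/

/-! ### Sources and the exchange argument -/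

namespace KnapsackExtendWeak

variable (K : KnapsackExtendWeak)

/-- The initial profit of the starting point `z`, extended by zero to all natural numbers. -/
def base (z : ℕ) : ℤ := if h : z < K.L then K.q ⟨z, h⟩ else 0

/-- The element of `S[z]`, or `0` if `S[z]` is empty (for sets with at most one element). -/
def weight (z : ℕ) : ℕ := if h : z < K.L then ∑ w ∈ K.S ⟨z, h⟩, w else 0

/-- The profit of the starting point `z` with as many copies of its weight as fit between `z`
and `u`. Rounding down makes this a step function defined at every `u ≥ z`. -/
def val (z u : ℕ) : ℤ :=
  K.base z + if K.weight z = 0 then 0 else K.Q (K.weight z) ((u - z) / K.weight z)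

/-- All maximizers for `i` are supported on the sets of their starting points. -/
def IsWeak (i : Fin K.L) : Prop :=
  ∀ (y : Fin K.L) (v : ℕ →₀ ℕ), K.IsMaximizer i y v → v.support ⊆ K.S y

/-- The promise of the problem applies to the index `i`, and the starting point `z`, with copies of
its weight, gives a maximizer for `i`. -/
def Wins (z i : ℕ) : Prop :=
  ∃ (hz : z < K.L) (hi : i < K.L), K.weight z ≠ 0 ∧ K.IsWeak ⟨i, hi⟩ ∧
    K.IsMaximizer ⟨i, hi⟩ ⟨z, hz⟩ (Finsupp.single (K.weight z) ((i - z) / K.weight z))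

variable {K}

lemma base_fin (z : Fin K.L) : K.base z = K.q z := by simp [base]

lemma weight_eq_of_mem (hS : ∀ i, (K.S i).card ≤ 1) {z : Fin K.L} {w : ℕ} (hw : w ∈ K.S z) :
    K.weight z = w := by
  have : K.S z = {w} := Finset.eq_singleton_iff_unique_mem.2
    ⟨hw, fun y hy => Finset.card_le_one.1 (hS z) y hy w hw⟩
  simp [weight, this]

lemma weight_mem {z : ℕ} (hS : ∀ i, (K.S i).card ≤ 1) (hw : K.weight z ≠ 0) :
    K.weight z ∈ K.U := by
  by_cases hz : z < K.L
  · have h : (K.S ⟨z, hz⟩).Nonempty := by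
      by_contra h
      rw [Finset.not_nonempty_iff_eq_empty] at h
      simp [weight, hz, h] at hw
    obtain ⟨w, h⟩ := h
    have := weight_eq_of_mem hS h
    rw [this]
    exact K.S_subset _ h
  · simp [weight, hz] at hw

lemma pos_of_mem {w : ℕ} (hw : w ∈ K.U) : 0 < w := (Finset.mem_Icc.1 (K.U_subset hw)).1

lemma val_of_mem {z : ℕ} (hw : K.weight z ∈ K.U) (u : ℕ) :
    K.val z u = K.base z + K.Q (K.weight z) ((u - z) / K.weight z) := by
  simp [val, (pos_of_mem hw).ne']

lemma val_self {z : ℕ} (hS : ∀ i, (K.S i).card ≤ 1) : K.val z z = K.base z := by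
  by_cases hw : K.weight z = 0
  · simp [val, hw]
  · simp [val_of_mem (weight_mem hS hw), K.Q_zero _ (weight_mem hS hw)]

/-- The gain from `d` further copies decreases with the number of copies already there. -/
lemma concave_gap {w : ℕ} (hw : w ∈ K.U) {a b : ℕ} (hab : a ≤ b) (d : ℕ) :
    K.Q w (b + d) - K.Q w b ≤ K.Q w (a + d) - K.Q w a := by
  have hanti : Antitone fun n => K.Q w (n + 1) - K.Q w n :=
    antitone_nat_of_succ_le fun n => (K.Q_concave w hw n).le
  induction d with
  | zero => simp
  | succ d ih =>
    have := hanti (Nat.add_le_add_right hab d)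
    simp only [← add_assoc] at this ⊢
    linarith

/-- A later source of the same weight and residue that has caught up stays ahead: this is the
concavity of the profit function. -/
lemma val_le_val_of_le {x y u v : ℕ} (hx : K.weight x ∈ K.U) (hxy : K.weight x = K.weight y)
    (h : x ≤ y) (hmod : x ≡ y [MOD K.weight y]) (hy : y ≤ u) (huv : u ≤ v)
    (hle : K.val x u ≤ K.val y u) : K.val x v ≤ K.val y v := by
  obtain ⟨e, he⟩ := (Nat.modEq_iff_dvd' h).1 hmod
  have hpos := pos_of_mem hx
  rw [val_of_mem hx, val_of_mem (hxy ▸ hx)] at *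
  rw [hxy] at hx hpos
  have split : ∀ t, y ≤ t → (t - x) / K.weight y = (t - y) / K.weight y + e := by
    intro t ht
    rw [show t - x = (t - y) + K.weight y * e by omega, Nat.add_mul_div_left _ _ hpos]
  rw [hxy, split _ (hy.trans huv)]
  rw [hxy, split _ hy] at hle
  have := concave_gap hx (Nat.div_le_div_right (c := K.weight y) (Nat.sub_le_sub_right huv y)) e
  linarith

lemma isSolution_single {i z : Fin K.L} {w k : ℕ} (hw : w ∈ K.U ∨ k = 0)
    (h : (z : ℕ) + w * k = i) : K.IsSolution i z (Finsupp.single w k) := by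
  constructor
  · rcases hw with hw | rfl
    · exact Finsupp.support_single_subset.trans (by simpa using hw)
    · simp
  · rcases hw with hw | rfl
    · rw [Finset.sum_eq_single w (fun v _ hv => by simp [Finsupp.single_eq_of_ne hv])
        (fun h => absurd hw h)]
      simpa using h
    · simpa using h

lemma profit_single {z : Fin K.L} {w : ℕ} (k : ℕ) (hw : w ∈ K.U) :
    K.profit z (Finsupp.single w k) = K.q z + K.Q w k := by
  unfold profit
  rw [Finset.sum_eq_single w (fun v hv hvw => by
    simp [Finsupp.single_eq_of_ne hvw, K.Q_zero v hv]) (fun h => absurd hw h)]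
  simp

lemma profit_zero (z : Fin K.L) : K.profit z 0 = K.q z := by
  unfold profit
  simp [Finset.sum_eq_zero fun v hv => K.Q_zero v hv]

lemma profit_single_weight {z : Fin K.L} {i : ℕ} (hw : K.weight z ∈ K.U) :
    K.profit z (Finsupp.single (K.weight z) ((i - z) / K.weight z)) = K.val z i := by
  rw [profit_single _ hw, val_of_mem hw, base_fin]

lemma add_mul_div_of_modEq {z i w : ℕ} (h : z ≤ i) (hmod : z ≡ i [MOD w]) :
    z + w * ((i - z) / w) = i := by
  rw [Nat.mul_div_cancel' ((Nat.modEq_iff_dvd' h).1 hmod)]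
  omega

lemma isSolution_add_single {p i z : Fin K.L} {x : ℕ →₀ ℕ} {w k : ℕ} (hw : w ∈ K.U)
    (hx : K.IsSolution p z x) (h : (p : ℕ) + w * k = i) :
    K.IsSolution i z (x + Finsupp.single w k) := by
  refine ⟨Finsupp.support_add.trans (Finset.union_subset hx.1
    (Finsupp.support_single_subset.trans (by simpa using hw))), ?_⟩
  have h1 := hx.2
  have h2 := (isSolution_single (i := ⟨w * k, by omega⟩) (z := ⟨0, by omega⟩) (w := w) (k := k)
    (.inl hw) (by simp)).2
  simp only [Finsupp.add_apply, mul_add, Finset.sum_add_distrib]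
  simp only at h2
  omega

lemma profit_add_single {z : Fin K.L} (x : ℕ →₀ ℕ) {w : ℕ} (k : ℕ) (hw : w ∈ K.U) :
    K.profit z (x + Finsupp.single w k) = K.profit z x + (K.Q w (x w + k) - K.Q w (x w)) := by
  unfold profit
  rw [← Finset.add_sum_erase _ _ hw, ← Finset.add_sum_erase (a := w) _ (fun v => K.Q v (x v)) hw]
  rw [Finset.sum_congr rfl (g := fun v => K.Q v (x v)) (fun v hv => by
    simp [Finsupp.single_eq_of_ne (Finset.ne_of_mem_erase hv)])]
  simp
  ring

namespace Wins

lemma weight_ne {z i : ℕ} (h : K.Wins z i) : K.weight z ≠ 0 := h.2.2.1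

lemma lt_right {z i : ℕ} (h : K.Wins z i) : i < K.L := h.2.1

lemma add_mul_div {z i : ℕ} (hS : ∀ i, (K.S i).card ≤ 1) (h : K.Wins z i) :
    z + K.weight z * ((i - z) / K.weight z) = i := by
  obtain ⟨hz, hi, hw, -, hm, -⟩ := h
  have := hm.2
  rw [Finset.sum_eq_single (K.weight z) (fun v _ hv => by simp [Finsupp.single_eq_of_ne hv])
    (fun h => absurd (weight_mem hS hw) h)] at this
  simpa using this

lemma le {z i : ℕ} (hS : ∀ i, (K.S i).card ≤ 1) (h : K.Wins z i) : z ≤ i :=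
  (Nat.le_add_right _ _).trans_eq (h.add_mul_div hS)

lemma modEq {z i : ℕ} (hS : ∀ i, (K.S i).card ≤ 1) (h : K.Wins z i) :
    z ≡ i [MOD K.weight z] := by
  conv_rhs => rw [← h.add_mul_div hS]
  simp [Nat.ModEq]

/-- The exchange argument. Any solution for an intermediate index `p` of the progression from `y`
to `i` that is at least as good as the one from `y`, and uses the weight of `y` no more often,
extends to a maximizer for `i`. -/
lemma exchange {y i : ℕ} (hS : ∀ i, (K.S i).card ≤ 1) (h : K.Wins y i) {p z : Fin K.L}
    {x : ℕ →₀ ℕ} (hyp : y ≤ p) (hpi : p ≤ i) (hmod : y ≡ p [MOD K.weight y])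
    (hx : K.IsSolution p z x) (hxw : x (K.weight y) ≤ (p - y) / K.weight y)
    (hle : K.val y p ≤ K.profit z x) :
    K.IsMaximizer ⟨i, h.lt_right⟩ z
      (x + Finsupp.single (K.weight y) ((i - p) / K.weight y)) := by
  have hw := weight_mem hS h.weight_ne
  have hpos := pos_of_mem hw
  have hmod' : (p : ℕ) ≡ i [MOD K.weight y] := hmod.symm.trans (h.modEq hS)
  have hpi' := add_mul_div_of_modEq hpi hmod'
  have hyp' := add_mul_div_of_modEq hyp hmod
  refine ⟨isSolution_add_single hw hx hpi', fun y' v hv => ?_⟩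
  have ⟨hz, hi, _, _, _, hmax⟩ := h
  refine (hmax y' v hv).trans ?_
  rw [profit_add_single _ _ hw, profit_single_weight (z := ⟨y, hz⟩) hw]
  have hsplit : (i - y) / K.weight y = (p - y) / K.weight y + (i - p) / K.weight y := by
    have : i - y = K.weight y * ((p - y) / K.weight y + (i - p) / K.weight y) := by
      rw [mul_add]; omega
    conv_lhs => rw [this]
    exact Nat.mul_div_cancel_left _ hpos
  have hgap := concave_gap hw hxw ((i - p) / K.weight y)
  rw [val_of_mem hw] at hle ⊢
  rw [hsplit]
  linarith

lemma isWeak {z i : ℕ} (h : K.Wins z i) : K.IsWeak ⟨i, h.lt_right⟩ := h.2.2.2.1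

/-- A source of the same weight and residue with at least the same profit wins as well. -/
lemma of_val_le {y z i : ℕ} (hS : ∀ i, (K.S i).card ≤ 1) (h : K.Wins y i) (hz : z ≤ i)
    (hw : K.weight z ≠ 0) (hmod : z ≡ i [MOD K.weight z])
    (hle : K.val y i ≤ K.val z i) : K.Wins z i := by
  have hzL := hz.trans_lt h.lt_right
  have hwU := weight_mem hS hw
  refine ⟨hzL, h.lt_right, hw, h.isWeak, isSolution_single (.inl hwU)
    (add_mul_div_of_modEq hz hmod), fun y' v hv => ?_⟩
  have ⟨hy, hi, hwy, _, _, hmax⟩ := h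
  refine (hmax y' v hv).trans ?_
  rw [profit_single_weight (z := ⟨y, hy⟩) (weight_mem hS hwy),
    profit_single_weight (z := ⟨z, hzL⟩) hwU]
  exact hle

/-- If the empty solution at an intermediate index `p` is at least as good as the one from `y`,
then `p` is a source of the same weight and wins too. -/
lemma of_val_le_base {y p i : ℕ} (hS : ∀ i, (K.S i).card ≤ 1) (h : K.Wins y i) (hyp : y ≤ p)
    (hpi : p < i) (hmod : y ≡ p [MOD K.weight y]) (hle : K.val y p ≤ K.base p) :
    K.Wins p i := by
  have hpL := hpi.trans h.lt_right
  have hpos := Nat.pos_of_ne_zero h.weight_ne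
  have hm := h.exchange hS (p := ⟨p, hpL⟩) (z := ⟨p, hpL⟩) (x := 0) hyp hpi.le hmod
    ⟨by simp, by simp⟩ (by simp) (by rw [profit_zero, ← base_fin]; exact hle)
  rw [zero_add] at hm
  have hmod' : p ≡ i [MOD K.weight y] := hmod.symm.trans (h.modEq hS)
  have hk : (i - p) / K.weight y ≠ 0 := by
    intro h0
    have := add_mul_div_of_modEq hpi.le hmod'
    rw [h0] at this
    omega
  have hmem := h.isWeak _ _ hm (by simpa using hk : K.weight y ∈ _)
  have hwp : K.weight p = K.weight y := weight_eq_of_mem hS hmem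
  refine ⟨hpL, h.lt_right, by rw [hwp]; exact h.weight_ne, h.isWeak, ?_⟩
  rw [hwp]
  exact hm

/-- A source of a different weight cannot be at least as good at an intermediate index before the
end: extended to `i`, it would give a maximizer with two different weights. -/
lemma val_lt_of_weight_ne {y z p i : ℕ} (hS : ∀ i, (K.S i).card ≤ 1) (h : K.Wins y i)
    (hyp : y ≤ p) (hpi : p < i) (hmod : y ≡ p [MOD K.weight y]) (hzp : z < p)
    (hw : K.weight z ≠ 0) (hmodz : z ≡ p [MOD K.weight z]) (hne : K.weight z ≠ K.weight y) :
    K.val z p < K.val y p := by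
  by_contra! hle
  have hpL := hpi.trans h.lt_right
  have hwU := weight_mem hS hw
  have hzk := add_mul_div_of_modEq hzp.le hmodz
  have hm := h.exchange hS (p := ⟨p, hpL⟩) (z := ⟨z, hzp.trans hpL⟩)
    (x := Finsupp.single (K.weight z) ((p - z) / K.weight z)) hyp hpi.le hmod
    (isSolution_single (.inl hwU) hzk) (by rw [Finsupp.single_eq_of_ne hne.symm]; simp)
    (by rw [profit_single_weight (z := ⟨z, hzp.trans hpL⟩) hwU]; exact hle)
  have hk : (i - p) / K.weight y ≠ 0 := by
    intro h0
    have := add_mul_div_of_modEq hpi.le (hmod.symm.trans (h.modEq hS))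
    rw [h0] at this
    omega
  have hmem : K.weight y ∈ K.S ⟨z, hzp.trans hpL⟩ := h.isWeak _ _ hm (by
    rw [Finsupp.mem_support_iff, Finsupp.add_apply, Finsupp.single_eq_same]
    exact fun h0 => hk (Nat.add_eq_zero_iff.1 h0).2)
  exact hne (weight_eq_of_mem hS hmem)

end Wins
end KnapsackExtendWeak

/-! ### Weakest preconditions with running time -/

namespace WordRAM

lemma State.setVar_var (s : State) (x y : ℕ) (v : ℤ) :
    (s.setVar x v).var y = if y = x then v else s.var y := by
  simp [State.setVar, Function.update_apply]

lemma State.setVar_arr (s : State) (x : ℕ) (v : ℤ) : (s.setVar x v).arr = s.arr := rfl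

lemma State.setVar_setVar (s : State) (x : ℕ) (u v : ℤ) :
    (s.setVar x u).setVar x v = s.setVar x v := by
  simp [State.setVar]

lemma State.setArr_var (s : State) (a j : ℕ) (v : ℤ) : (s.setArr a j v).var = s.var := rfl

lemma State.setArr_arr (s : State) (a j a' j' : ℕ) (v : ℤ) :
    (s.setArr a j v).arr a' j' = if a' = a ∧ j' = j then v else s.arr a' j' := by
  by_cases h : a' = a
  · subst h; simp [State.setArr, Function.update_apply]
  · simp [State.setArr, h]

/-- The weakest precondition, for total correctness, with the running time as an argument of the
postcondition. -/
def wp (b : ℕ) (O : Oracle) (p : Cmd) (Q : ℕ → State → Prop) (s : State) : Prop :=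
  ∃ t r, Exec b O p s t r ∧ Q t r

variable {b : ℕ} {O : Oracle} {p p₂ : Cmd} {Q : ℕ → State → Prop} {s : State}

lemma wp.mono {R : ℕ → State → Prop} (h : wp b O p R s) (hQ : ∀ t r, R t r → Q t r) :
    wp b O p Q s := by
  obtain ⟨t, r, he, hr⟩ := h
  exact ⟨t, r, he, hQ _ _ hr⟩

lemma wp_skip (h : Q 1 s) : wp b O .skip Q s := ⟨_, _, .skip s, h⟩

lemma wp_assign {x : ℕ} {e : Expr} (v : ℤ) (he : e.eval b O s = some v)
    (h : Q (e.cost + 1) (s.setVar x v)) : wp b O (.assign x e) Q s :=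
  ⟨_, _, .assign he, h⟩

lemma wp_store {a : ℕ} {i e : Expr} (j : ℕ) (v : ℤ) (hi : i.eval b O s = some (j : ℤ))
    (he : e.eval b O s = some v)
    (h : Q (i.cost + e.cost + 1) (s.setArr a j v)) : wp b O (.store a i e) Q s :=
  ⟨_, _, .store hi (Int.natCast_nonneg j) he, h⟩

lemma wp_seq (h : wp b O p (fun t => wp b O p₂ fun t₂ => Q (t + t₂)) s) :
    wp b O (.seq p p₂) Q s := by
  obtain ⟨t, r, he, t₂, r₂, he₂, h⟩ := h
  exact ⟨_, _, .seq he he₂, h⟩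

lemma wp_cond {e : Expr} (v : ℤ) (he : e.eval b O s = some v)
    (h₁ : v ≠ 0 → wp b O p (fun t => Q (e.cost + 1 + t)) s)
    (h₂ : v = 0 → wp b O p₂ (fun t => Q (e.cost + 1 + t)) s) : wp b O (.cond e p p₂) Q s := by
  by_cases hv : v = 0
  · obtain ⟨t, r, hr, h⟩ := h₂ hv
    exact ⟨_, _, .cond_false (hv ▸ he) hr, h⟩
  · obtain ⟨t, r, hr, h⟩ := h₁ hv
    exact ⟨_, _, .cond_true he hv hr, h⟩

lemma wp_loop {e : Expr} (v : ℤ) (he : e.eval b O s = some v)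
    (h₁ : v ≠ 0 → wp b O p (fun t => wp b O (.loop e p) fun t₂ => Q (e.cost + 1 + t + t₂)) s)
    (h₂ : v = 0 → Q (e.cost + 1) s) : wp b O (.loop e p) Q s := by
  by_cases hv : v = 0
  · exact ⟨_, _, .loop_false (hv ▸ he), h₂ hv⟩
  · obtain ⟨t, r, hr, t₂, r₂, hr₂, h⟩ := h₁ hv
    exact ⟨_, _, .loop_true he hv hr hr₂, h⟩

/-- The commands of a list, one after the other. -/
def Cmd.block : List Cmd → Cmd
  | [] => .skip
  | [p] => p
  | p :: p₂ :: l => .seq p (block (p₂ :: l))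

lemma wp_block {l : List Cmd}
    (h : wp b O p (fun t => wp b O (.block (p₂ :: l)) fun t₂ => Q (t + t₂)) s) :
    wp b O (.block (p :: p₂ :: l)) Q s := wp_seq h

/-- The expression `e + 1`. -/
abbrev Expr.inc (e : Expr) : Expr := .add e (.const 1)

end WordRAM

/-! ### The program -/

namespace KnapsackExtendWeak
open WordRAM

variable {K : KnapsackExtendWeak}

/-- `M` bounds the input, and numbers below `32 * M` fit in a word of length `b`. The factor leaves
room for the constants of the program and for sums of a few input numbers. -/
structure Fits (K : KnapsackExtendWeak) (b : ℕ) (M : ℤ) : Prop where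
  fit : ∀ v : ℤ, -(32 * M) < v → v < 32 * M → fit b v = some v
  L_lt : (K.L : ℤ) < M
  weight_lt : ∀ w ∈ K.U, (w : ℤ) < M
  base_gt : ∀ z, -M < K.base z
  base_lt : ∀ z, K.base z < M
  Q_gt : ∀ w ∈ K.U, ∀ k, w * k < K.L → -M < K.Q w k
  Q_lt : ∀ w ∈ K.U, ∀ k, w * k < K.L → K.Q w k < M

lemma FitsIn.fits {W : ℕ} (h : K.FitsIn W) : K.Fits (W + 5) (2 ^ W) := by
  obtain ⟨hL, hU, hq, hQ⟩ := h
  have hpos : (0 : ℤ) < 2 ^ W := by positivity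
  have hbase : ∀ z, |K.base z| < 2 ^ W := by
    intro z
    unfold base
    split
    · exact hq _
    · simp
  refine ⟨fun v h1 h2 => ?_, by exact_mod_cast hL, fun w hw => by exact_mod_cast hU w hw,
    fun z => (abs_lt.1 (hbase z)).1, fun z => (abs_lt.1 (hbase z)).2,
    fun w hw k hk => (abs_lt.1 (hQ w hw k hk)).1, fun w hw k hk => (abs_lt.1 (hQ w hw k hk)).2⟩
  rw [WordRAM.fit, if_pos]
  rw [abs_lt, pow_add]
  constructor <;> linarith

namespace Fits
variable {b : ℕ} {M : ℤ} (F : K.Fits b M)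

include F in
lemma fit_ite (c : Prop) [Decidable c] :
    WordRAM.fit b (if c then 1 else 0) = some (if c then 1 else 0) := by
  have := F.L_lt
  split <;> exact F.fit _ (by omega) (by omega)

include F in
lemma val_bound (hS : ∀ i, (K.S i).card ≤ 1) (z : ℕ) {u : ℕ} (hu : u < K.L) :
    -(2 * M) < K.val z u ∧ K.val z u < 2 * M := by
  have h1 := F.base_gt z
  have h2 := F.base_lt z
  by_cases hw : K.weight z = 0
  · simp only [val, hw]
    constructor <;> simp <;> linarith [F.L_lt]
  · have hU := weight_mem hS hw
    have hk : K.weight z * ((u - z) / K.weight z) < K.L :=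
      ((Nat.mul_div_le _ _).trans (Nat.sub_le u z)).trans_lt hu
    have h3 := F.Q_gt _ hU _ hk
    have h4 := F.Q_lt _ hU _ hk
    rw [val_of_mem hU]
    omega

end Fits

/-- The expression for `val z u`, when the variable 4 holds the weight of `z`. -/
def valExpr (z u : Expr) : Expr :=
  .add (.load 0 z) (.query (.var 4) (.div (.sub u z) (.var 4)))

lemma Fits.eval_valExpr {b : ℕ} {M : ℤ} (F : K.Fits b M) {s : State} {z u : Expr} {zv uv : ℕ}
    (h0 : ∀ x < K.L, s.arr 0 x = K.base x) (hU : K.weight zv ∈ K.U)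
    (hw : s.var 4 = K.weight zv) (hz : z.eval b K.oracle s = some (zv : ℤ))
    (hu : u.eval b K.oracle s = some (uv : ℤ)) (hzu : zv ≤ uv) (huL : uv < K.L) :
    (valExpr z u).eval b K.oracle s = some (K.val zv uv) := by
  have hpos := pos_of_mem hU
  have hk : K.weight zv * ((uv - zv) / K.weight zv) < K.L :=
    ((Nat.mul_div_le _ _).trans (Nat.sub_le uv zv)).trans_lt huL
  have := F.Q_gt _ hU _ hk
  have := F.Q_lt _ hU _ hk
  have := F.base_gt zv
  have := F.base_lt zv
  have := F.L_lt
  have hdiv := Nat.div_le_self (uv - zv) (K.weight zv)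
  have hdiv0 : (0 : ℤ) ≤ ((uv - zv : ℕ) : ℤ) / (K.weight zv : ℤ) := by positivity
  have hsub : (uv : ℤ) - zv = (uv - zv : ℕ) := by omega
  have hcast : ((uv - zv : ℕ) : ℤ) / (K.weight zv : ℤ) = ((uv - zv) / K.weight zv : ℕ) := by
    norm_cast
  have hb : K.oracle (K.weight zv) (((uv - zv) / K.weight zv : ℕ) : ℤ) =
      some (K.Q (K.weight zv) ((uv - zv) / K.weight zv)) := by
    simp only [oracle]
    rw [if_pos ⟨by omega, by simpa using hU, by omega⟩]
    simp only [Int.toNat_natCast]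
  simp only [valExpr, Expr.eval, hz, hu, hw, Option.bind_some, Int.natCast_nonneg, if_true,
    Int.toNat_natCast, h0 zv (by omega), hsub]
  rw [F.fit _ (by omega) (by omega), Option.bind_some, if_neg (by omega), hcast,
    F.fit _ (by omega) (by omega), Option.bind_some, hb, Option.bind_some,
    F.fit _ (by omega) (by omega), Option.bind_some, F.fit _ (by omega) (by omega), val_of_mem hU]

/-! Scalar variables:
* 0 holds `L`, and 1 holds the current index `j`;
* 2, 3 and 4 hold the head, the tail and the weight of the current queue;
* 5 holds the next index `i = j + w` of the progression;
* 6, 7 and 8 hold the bounds and the midpoint of the binary search, and 9 holds a profit.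

Arrays:
* 0 and 1 hold the input, and 2, 3, 4, 5 the output; before the sweep arrives at an index, array 3
  holds the profit there of the queue that waits there;
* 6 and 7 hold, at an index, the head plus one and the tail of the queue waiting there (0 in
  array 6 means that there is none);
* 8 and 9 hold, at a source, its successor and its predecessor in its queue;
* 10 holds, at a source, the time at which it catches up with its predecessor.

The index `L` is the successor of the last source of a queue, and array 10 holds `L` there, so that
removals from the front stop at the last source. -/

/-- Removes from the back of the queue that ends in `var 3` the sources which the new source
`var 1` catches up with before they become best. In `append`, the entry of the head in array 10 is
the current index, at which the new source is behind the head, so that the loop stops there at the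
latest. -/
def popBack : Cmd :=
  .loop (.lt (valExpr (.var 3) (.load 10 (.var 3)))
      (.inc (valExpr (.var 1) (.load 10 (.var 3)))))
    (.assign 3 (.load 9 (.var 3)))

/-- Binary search for the first time `var 7` at which `var 1` catches up with `var 3`.
The value `L` means that this does not happen in the range of the problem. -/
def search : Cmd :=
  .loop (.lt (.inc (.var 6)) (.var 7)) (.block [
    .assign 8 (.div (.add (.var 6) (.var 7)) (.const 2)),
    .cond (.lt (valExpr (.var 1) (.var 8)) (valExpr (.var 3) (.var 8)))
      (.assign 6 (.var 8)) (.assign 7 (.var 8))])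

/-- Adds the source `var 1` to the queue from `var 2` to `var 3`, of the same weight `var 4`. -/
def append : Cmd := .block [
  .store 10 (.var 2) (.var 1),
  popBack,
  .assign 6 (.load 10 (.var 3)),
  .assign 7 (.var 0),
  search,
  .store 9 (.var 1) (.var 3),
  .store 10 (.var 1) (.var 7),
  .cond (.lt (.var 7) (.var 0))
    (.block [.store 8 (.var 3) (.var 1), .assign 3 (.var 1)])
    (.store 8 (.var 3) (.var 0))]

/-- Removes from the front of the queue that begins with `var 2` the sources which the next one has
caught up with at the index `var 5`. -/
def popFront : Cmd :=
  .loop (.lt (.load 10 (.load 8 (.var 2))) (.inc (.var 5))) (.assign 2 (.load 8 (.var 2)))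

/-- Makes the queue from `var 2` to `var 3` wait at the index `var 5`, unless a queue waits there
whose best offer is at least as good. -/
def push : Cmd := .block [
  popFront,
  .assign 9 (valExpr (.var 2) (.var 5)),
  .cond (.mul (.lt (.var 9) (.inc (.load 3 (.var 5)))) (.load 6 (.var 5)))
    .skip
    (.block [
      .store 6 (.var 5) (.inc (.var 2)),
      .store 7 (.var 5) (.var 3),
      .store 3 (.var 5) (.var 9)])]

/-- Chooses between the queue waiting at the index `var 1` and the starting point `var 1` itself. If
the queue is better and has the same weight, the starting point joins it. -/
def choose : Cmd := .block [
  .store 8 (.var 1) (.var 0),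
  .cond (.mul (.lt (.load 0 (.var 1)) (.load 3 (.var 1))) (.load 6 (.var 1)))
    (.block [
      .assign 2 (.sub (.load 6 (.var 1)) (.const 1)),
      .assign 3 (.load 7 (.var 1)),
      .assign 4 (.load 1 (.var 2)),
      .cond (.eq (.var 4) (.load 1 (.var 1))) append .skip])
    (.block [
      .assign 2 (.var 1),
      .assign 3 (.var 1),
      .assign 4 (.load 1 (.var 1)),
      .store 3 (.var 1) (.load 0 (.var 1))])]

/-- One step of the sweep: determine the surviving queue at the index `var 1`, write the output, and
pass the queue on. -/
def body : Cmd := .block [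
  choose,
  .store 2 (.var 1) (.var 2),
  .store 4 (.var 1) (.var 4),
  .cond (.var 4)
    (.block [
      .store 5 (.var 1) (.div (.sub (.var 1) (.var 2)) (.var 4)),
      .assign 5 (.add (.var 1) (.var 4)),
      .cond (.lt (.var 5) (.var 0)) push .skip])
    (.store 5 (.var 1) (.const 0)),
  .assign 1 (.inc (.var 1))]

/-- The sweep over all indices, after the sentinel has been set. -/
def program : Cmd := .block [
  .store 10 (.var 0) (.var 0),
  .loop (.lt (.var 1) (.var 0)) body]

/-! ### Appending a source to a queue -/


/-- `y` follows `x` in a queue of sources stored in the memory: the arrays 8 and 9 hold the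
successor and the predecessor, and the array 10 holds at `y` the first time at which `y` catches up
with `x`. -/
def Link (K : KnapsackExtendWeak) (A : ℕ → ℕ → ℤ) (x y : ℕ) : Prop :=
  A 8 x = y ∧ A 9 y = x ∧ x < y ∧ ∃ τ : ℕ, A 10 y = τ ∧ A 10 x < τ ∧ τ < K.L ∧
    ∀ u, y ≤ u → u < K.L → (τ ≤ u ↔ K.val x u ≤ K.val y u)

lemma isChain_concat {α : Type*} {R : α → α → Prop} {l : List α} {x y : α}
    (hx : l.getLast? = some x) :
    (l ++ [y]).IsChain R ↔ l.IsChain R ∧ R x y := by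
  rw [List.isChain_append]
  simp [hx]

section
variable {b : ℕ} {M : ℤ} (F : K.Fits b M)
include F

/-- The source `j` and a prefix of the queue are together as good, at all times from `j` on, as the
whole queue. A removal costs at most 40 steps. -/
lemma popBack_spec (hS : ∀ i, (K.S i).card ≤ 1) {d : List ℕ} {s : State} {j h t : ℕ}
    (h0 : ∀ x < K.L, s.arr 0 x = K.base x) (hj : s.var 1 = j) (ht : s.var 3 = t)
    (hw : s.var 4 = K.weight j) (hU : K.weight j ∈ K.U)
    (hd : d.head? = some h) (hl : d.getLast? = some t)
    (hm : ∀ y ∈ d, K.weight y = K.weight j ∧ y < j ∧ y ≡ j [MOD K.weight j])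
    (hc : d.IsChain (K.Link s.arr)) (ha : ∀ y ∈ d, ∃ τ : ℕ, s.arr 10 y = τ ∧ j ≤ τ ∧ τ < K.L)
    (hh : s.arr 10 h = j) (hlt : K.base j < K.val h j) :
    wp b K.oracle popBack (fun n r => ∃ (d' : List ℕ) (t' : ℕ), r = s.setVar 3 t' ∧ d' <+: d ∧
      d'.head? = some h ∧ d'.getLast? = some t' ∧ n + 40 * d'.length ≤ 40 * d.length + 40 ∧
      (∀ τ : ℕ, s.arr 10 t' = τ → K.val j τ < K.val t' τ) ∧
      ∀ y ∈ d, ∀ u, j ≤ u → u < K.L → K.val y u ≤ K.val j u ∨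
        ∃ y' ∈ d', K.val y u ≤ K.val y' u) s := by
  induction d using List.reverseRecOn generalizing s t with
  | nil => simp at hd
  | append_singleton d t₀ ih =>
    obtain rfl : t₀ = t := by simpa using hl
    obtain ⟨hwt, htj, htm⟩ := hm t₀ (by simp)
    obtain ⟨τ, hτ, hjτ, hτL⟩ := ha t₀ (by simp)
    have hb1 := F.val_bound hS j hτL
    have hb2 := F.val_bound hS t₀ hτL
    have hload : (Expr.load 10 (.var 3)).eval b K.oracle s = some (τ : ℤ) := by
      simp [Expr.eval, ht, hτ]
    have e1 := F.eval_valExpr h0 (hwt ▸ hU) (hwt ▸ hw) (z := .var 3) (zv := t₀)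
      (by simp [Expr.eval, ht]) hload (by omega) hτL
    have e2 := F.eval_valExpr h0 hU hw (z := .var 1) (zv := j)
      (by simp [Expr.eval, hj]) hload (by omega) hτL
    refine wp_loop (if K.val t₀ τ < K.val j τ + 1 then 1 else 0) ?_ ?_ ?_
    · have := F.L_lt
      rw [Expr.eval, e1, Option.bind_some, Expr.eval, e2, Option.bind_some, Expr.eval,
        F.fit 1 (by omega) (by omega), Option.bind_some, F.fit _ (by omega) (by omega),
        Option.bind_some, F.fit_ite]
    · intro hne
      have hle : K.val t₀ τ ≤ K.val j τ := by
        by_contra hcon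
        exact hne (if_neg (by omega))
      have hdne : d ≠ [] := by
        rintro rfl
        obtain rfl : t₀ = h := by simpa using hd
        obtain rfl : j = τ := by exact_mod_cast hh.symm.trans hτ
        rw [val_self hS] at hle
        omega
      obtain ⟨x, hx⟩ : ∃ x, d.getLast? = some x := ⟨_, List.getLast?_eq_some_getLast hdne⟩
      rw [isChain_concat hx] at hc
      obtain ⟨hc, hl8, hl9, hxt, τ', hτ', hxτ, -, hcross⟩ := hc
      obtain rfl : τ = τ' := by exact_mod_cast hτ.symm.trans hτ'
      have hxd : x ∈ d := List.mem_of_getLast? hx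
      refine wp_assign (x : ℤ) (by simp [Expr.eval, ht, hl9]) ?_
      refine (ih (s := s.setVar 3 x) (t := x) h0 (by simp [State.setVar_var, hj])
        (by simp [State.setVar_var]) (by simp [State.setVar_var, hw])
        (by rwa [List.head?_append_of_ne_nil _ hdne] at hd) hx
        (fun y hy => hm y (by simp [hy])) hc (fun y hy => ha y (by simp [hy])) hh).mono ?_
      rintro n r ⟨d', t', rfl, hpre, hh', hl', hn, hlast, hcov⟩
      refine ⟨d', t', State.setVar_setVar _ _ _ _, hpre.trans (List.prefix_append _ _), hh', hl',
        ?_, hlast, ?_⟩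
      · simp [Expr.cost, valExpr]
        omega
      · intro y hy u hju huL
        rcases List.mem_append.1 hy with hy | hy
        · exact hcov y hy u hju huL
        · obtain rfl : y = t₀ := by simpa using hy
          -- the removed source is not better than the new one from `τ` on, and not better than
          -- its predecessor before
          by_cases hu : τ ≤ u
          · exact .inl (val_le_val_of_le (hwt ▸ hU) hwt htj.le htm hjτ hu hle)
          · have hxy : K.val y u ≤ K.val x u :=
              (not_le.1 fun hcon => hu ((hcross u (by omega) huL).2 hcon)).le
            rcases hcov x hxd u hju huL with h1 | ⟨y', hy', h1⟩
            · exact .inl (hxy.trans h1)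
            · exact .inr ⟨y', hy', hxy.trans h1⟩
    · intro hne
      refine ⟨d ++ [t₀], t₀, ?_, List.prefix_rfl, hd, by simp, ?_, ?_, ?_⟩
      · simp [State.setVar, ← ht]
      · simp [Expr.cost, valExpr]
        omega
      · intro τ' hτ'
        obtain rfl : τ = τ' := by exact_mod_cast hτ.symm.trans hτ'
        by_contra hcon
        rw [if_pos (by omega)] at hne
        exact one_ne_zero hne
      · exact fun y hy u _ _ => .inr ⟨y, hy, le_rfl⟩

/-- Binary search for the time `τ` at which `j` catches up with `t`, on an interval of length at
most `2 ^ n`. At the upper end `j` has caught up, or this end is `L`. -/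
lemma search_spec (n : ℕ) {s : State} {j t lo hi : ℕ} (h0 : ∀ x < K.L, s.arr 0 x = K.base x)
    (hj : s.var 1 = j) (ht : s.var 3 = t) (hw : s.var 4 = K.weight j) (hU : K.weight j ∈ K.U)
    (hlo : s.var 6 = lo) (hhi : s.var 7 = hi) (hwt : K.weight t = K.weight j) (htj : t < j)
    (htm : t ≡ j [MOD K.weight j]) (hjlo : j ≤ lo) (hlohi : lo < hi) (hL : hi ≤ K.L)
    (hlt : K.val j lo < K.val t lo) (hle : hi < K.L → K.val t hi ≤ K.val j hi)
    (hn : hi - lo ≤ 2 ^ n) :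
    wp b K.oracle search (fun m r => m ≤ 60 * n + 10 ∧ r.arr = s.arr ∧
      (∀ x, x < 6 → r.var x = s.var x) ∧
      ∃ τ : ℕ, r.var 7 = τ ∧ lo < τ ∧ τ ≤ K.L ∧
        ∀ u, j ≤ u → u < K.L → (τ ≤ u ↔ K.val t u ≤ K.val j u)) s := by
  have hML := F.L_lt
  induction n generalizing s lo hi with
  | zero =>
    refine wp_loop 0 ?_ (fun h => absurd rfl h) fun _ => ?_
    · simp only [Expr.eval, hlo, hhi, Option.bind_some]
      rw [F.fit 1 (by omega) (by omega), Option.bind_some, F.fit _ (by omega) (by omega),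
        Option.bind_some, F.fit_ite, if_neg (by simp at hn; omega)]
    · refine ⟨by simp [Expr.cost], rfl, fun _ _ => rfl, hi, hhi, hlohi, hL, fun u hju hu => ?_⟩
      constructor
      · intro hu'
        exact val_le_val_of_le (hwt ▸ hU) hwt htj.le htm (by omega) hu' (hle (by omega))
      · intro hle'
        by_contra hcon
        have := val_le_val_of_le (v := lo) (hwt ▸ hU) hwt htj.le htm hju (by simp at hn; omega) hle'
        omega
  | succ n ih =>
    by_cases h_half : hi - lo ≤ 2 ^ n
    · exact (ih h0 hj ht hw hlo hhi hjlo hlohi hL hlt hle h_half).mono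
        fun m r ⟨hm, hr⟩ => ⟨by omega, hr⟩
    have h1 : 1 ≤ 2 ^ n := Nat.one_le_two_pow
    rw [pow_succ] at hn
    refine wp_loop 1 ?_ (fun _ => ?_) (fun h => absurd h one_ne_zero)
    · simp only [Expr.eval, hlo, hhi, Option.bind_some]
      rw [F.fit 1 (by omega) (by omega), Option.bind_some, F.fit _ (by omega) (by omega),
        Option.bind_some, F.fit_ite, if_pos (by omega)]
    obtain ⟨mid, hmid⟩ : ∃ mid, mid = (lo + hi) / 2 := ⟨_, rfl⟩
    have hmL : mid < K.L := by omega
    refine wp_block (wp_assign (mid : ℤ) ?_ ?_)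
    · simp only [Expr.eval, hlo, hhi, Option.bind_some]
      rw [F.fit _ (by omega) (by omega), Option.bind_some, F.fit 2 (by omega) (by omega),
        Option.bind_some, if_neg (by omega), F.fit _ (by omega) (by omega)]
      congr 1; omega
    set s' := s.setVar 8 mid with hs'
    have h8 : s'.var 8 = mid := by simp [hs', State.setVar_var]
    have hj' : s'.var 1 = j := by simp [hs', State.setVar_var, hj]
    have ht' : s'.var 3 = t := by simp [hs', State.setVar_var, ht]
    have hw' : s'.var 4 = K.weight j := by simp [hs', State.setVar_var, hw]
    have e1 := F.eval_valExpr (s := s') h0 (hwt ▸ hU) (hwt ▸ hw') (z := .var 3) (u := .var 8)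
      (zv := t) (uv := mid) (by simp [Expr.eval, ht']) (by simp [Expr.eval, h8]) (by omega) hmL
    have e2 := F.eval_valExpr (s := s') h0 hU hw' (z := .var 1) (u := .var 8)
      (zv := j) (uv := mid) (by simp [Expr.eval, hj']) (by simp [Expr.eval, h8]) (by omega) hmL
    refine wp_cond (if K.val j mid < K.val t mid then 1 else 0) ?_ (fun hne => ?_) (fun hne => ?_)
    · rw [Expr.eval, e2, Option.bind_some, e1, Option.bind_some, F.fit_ite]
    · have hlt' : K.val j mid < K.val t mid := by
        by_contra hcon
        exact hne (if_neg hcon)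
      refine wp_assign (mid : ℤ) (by simp [Expr.eval, h8]) ?_
      refine (ih (s := s'.setVar 6 mid) (lo := mid) (hi := hi) h0 (by simp [State.setVar_var, hj'])
        (by simp [State.setVar_var, ht']) (by simp [State.setVar_var, hw'])
        (by simp [State.setVar_var]) (by simp [hs', State.setVar_var, hhi])
        (by omega) (by omega) hL hlt' hle (by omega)).mono ?_
      rintro m r ⟨hm, hr, hv, τ, h7, hτ, hcr⟩
      refine ⟨?_, hr, fun x hx => ?_, τ, h7, by omega, hcr⟩
      · simp [Expr.cost, valExpr]; omega
      · rw [hv x hx, State.setVar_var, if_neg (by omega), hs', State.setVar_var, if_neg (by omega)]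
    · have hle' : K.val t mid ≤ K.val j mid := by
        by_contra hcon
        rw [if_pos (by omega)] at hne
        exact one_ne_zero hne
      refine wp_assign (mid : ℤ) (by simp [Expr.eval, h8]) ?_
      refine (ih (s := s'.setVar 7 mid) (lo := lo) (hi := mid) h0 (by simp [State.setVar_var, hj'])
        (by simp [State.setVar_var, ht']) (by simp [State.setVar_var, hw'])
        (by simp [hs', State.setVar_var, hlo]) (by simp [State.setVar_var])
        (by omega) (by omega) (by omega) hlt (fun _ => hle') (by omega)).mono ?_
      rintro m r ⟨hm, hr, hv, τ, h7, hτ, hcr⟩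
      refine ⟨?_, hr, fun x hx => ?_, τ, h7, by omega, hcr⟩
      · simp [Expr.cost, valExpr]; omega
      · rw [hv x hx, State.setVar_var, if_neg (by omega), hs', State.setVar_var, if_neg (by omega)]

end
/-- The memory holds the queue `d` of sources, from `h` to `t`, at the index `p`. All have the same
weight and residue, and none of them has been overtaken by its successor at `p`, so that `h` is
the best one at `p`. The array 8 marks the end by the index `L`. -/
structure Deque (K : KnapsackExtendWeak) (A : ℕ → ℕ → ℤ) (p h t : ℕ) (d : List ℕ) : Prop where
  head : d.head? = some h
  last : d.getLast? = some t
  weight_eq : ∀ z ∈ d, K.weight z = K.weight h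
  le : ∀ z ∈ d, z ≤ p
  modEq : ∀ z ∈ d, z ≡ p [MOD K.weight h]
  chain : d.IsChain (K.Link A)
  next : A 8 t = K.L
  later : ∀ z ∈ d, z ≠ h → ∃ τ : ℕ, A 10 z = τ ∧ p < τ ∧ τ < K.L

lemma Link.lt {A : ℕ → ℕ → ℤ} {x y : ℕ} (h : K.Link A x y) : x < y := h.2.2.1

lemma pairwise_of_isChain_link {A : ℕ → ℕ → ℤ} {d : List ℕ} (h : d.IsChain (K.Link A)) :
    d.Pairwise (· < ·) :=
  List.isChain_iff_pairwise.1 (h.imp fun _ _ hl => hl.lt)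

lemma head_le_of_mem {d : List ℕ} {h z : ℕ} (hd : d.Pairwise (· < ·)) (hh : d.head? = some h)
    (hz : z ∈ d) : h ≤ z := by
  cases d with
  | nil => simp at hz
  | cons x d =>
    obtain rfl : x = h := by simpa using hh
    rcases List.mem_cons.1 hz with rfl | hz
    · exact le_rfl
    · exact ((List.pairwise_cons.1 hd).1 z hz).le

lemma le_last_of_mem {d : List ℕ} {t z : ℕ} (hd : d.Pairwise (· < ·)) (ht : d.getLast? = some t)
    (hz : z ∈ d) : z ≤ t := by
  rcases List.eq_nil_or_concat' d with rfl | ⟨d', x, rfl⟩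
  · simp at hz
  · obtain rfl : x = t := by simpa using ht
    rcases List.mem_append.1 hz with hz | hz
    · exact ((List.pairwise_append.1 hd).2.2 z hz x (by simp)).le
    · simp at hz; omega

namespace Deque
variable {A : ℕ → ℕ → ℤ} {p h t : ℕ} {d : List ℕ}

lemma head_mem (D : K.Deque A p h t d) : h ∈ d := List.mem_of_head? D.head

lemma last_mem (D : K.Deque A p h t d) : t ∈ d := List.mem_of_getLast? D.last

lemma singleton {A : ℕ → ℕ → ℤ} {j : ℕ} (h : A 8 j = K.L) : K.Deque A j j j [j] where
  head := rfl
  last := rfl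
  weight_eq := by simp
  le := by simp
  modEq := by simpa using Nat.ModEq.refl j
  chain := .singleton _
  next := h
  later := by simp

lemma val_le_head (D : K.Deque A p h t d) (hp : p < K.L) {z : ℕ} (hz : z ∈ d) :
    K.val z p ≤ K.val h p := by
  have hhead := D.head
  have hle := D.le
  have hchain := D.chain
  have hlater := D.later
  clear D
  induction d generalizing h with
  | nil => simp at hz
  | cons x d ih =>
    obtain rfl : x = h := by simpa using hhead
    rcases List.mem_cons.1 hz with rfl | hz'
    · exact le_rfl
    cases d with
    | nil => simp at hz'
    | cons y d =>
      have hpw := pairwise_of_isChain_link hchain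
      rw [List.isChain_cons_cons] at hchain
      obtain ⟨⟨-, -, hxy, τ, hτ, -, -, hcr⟩, hchain⟩ := hchain
      obtain ⟨τ', hτ', hpτ, -⟩ := hlater y (by simp) hxy.ne'
      obtain rfl : τ = τ' := by exact_mod_cast hτ.symm.trans hτ'
      have h1 : K.val y p ≤ K.val x p := by
        by_contra hcon
        have := (hcr p (hle y (by simp)) hp).2 (by omega)
        omega
      refine (ih hz' rfl (fun z hz => hle z (by simp [hz])) hchain
        fun z hz hne => hlater z (by simp [hz]) ?_).trans h1
      exact ((List.pairwise_cons.1 hpw).1 z hz).ne'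

/-- A queue is unaffected by changes of the arrays elsewhere. -/
lemma congr (D : K.Deque A p h t d) {B : ℕ → ℕ → ℤ}
    (h8 : ∀ z ∈ d, B 8 z = A 8 z) (h9 : ∀ z ∈ d, B 9 z = A 9 z) (h10 : ∀ z ∈ d, B 10 z = A 10 z) :
    K.Deque B p h t d where
  head := D.head
  last := D.last
  weight_eq := D.weight_eq
  le := D.le
  modEq := D.modEq
  chain := D.chain.imp_of_mem_imp fun x y hx hy hl => by
    unfold Link at *
    rwa [h8 x hx, h9 y hy, h10 y hy, h10 x hx]
  next := (h8 t D.last_mem).trans D.next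
  later z hz hne := by rw [h10 z hz]; exact D.later z hz hne

end Deque

section
variable {b : ℕ} {M : ℤ} (F : K.Fits b M)
include F

/-- A queue at `j` of the weight of `j` absorbs the source `j`, and at all later times the new queue
is as good as the old one and `j` together. -/
lemma append_spec (hS : ∀ i, (K.S i).card ≤ 1) {d : List ℕ} {s : State} {j h t : ℕ}
    (h0 : ∀ x < K.L, s.arr 0 x = K.base x) (hL : s.var 0 = K.L)
    (hj : s.var 1 = j) (hh : s.var 2 = h) (ht : s.var 3 = t) (hw : s.var 4 = K.weight j)
    (hU : K.weight j ∈ K.U) (D : K.Deque s.arr j h t d) (hwh : K.weight h = K.weight j)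
    (hdj : ∀ z ∈ d, z < j) (h8 : s.arr 8 j = K.L) (hjL : j < K.L)
    (hlt : K.base j < K.val h j) :
    wp b K.oracle append (fun n r => ∃ (d' : List ℕ) (t' : ℕ),
      n + 40 * d'.length ≤ 40 * d.length + 60 * (Nat.log 2 K.L + 1) + 150 ∧
      (∀ x < 3, r.var x = s.var x) ∧ r.var 3 = t' ∧ r.var 4 = K.weight j ∧
      (∀ a x, a < 8 ∨ 10 < a ∨ (x ≠ j ∧ x ∉ d) → r.arr a x = s.arr a x) ∧
      K.Deque r.arr j h t' d' ∧ (∀ z ∈ d', z ∈ d ∨ z = j) ∧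
      ∀ y, y ∈ d ∨ y = j → ∀ u, j ≤ u → u < K.L → ∃ y' ∈ d', K.val y u ≤ K.val y' u) s := by
  have hML := F.L_lt
  refine wp_block (wp_store h j (by simp [Expr.eval, hh]) (by simp [Expr.eval, hj]) ?_)
  set s₁ := s.setArr 10 h j with hs₁
  have hhd := D.head_mem
  have hpw := pairwise_of_isChain_link D.chain
  have hchain₁ : d.IsChain (K.Link s₁.arr) := by
    refine D.chain.imp_of_mem_imp fun x y hx hy hl => ?_
    have hyh : y ≠ h := ((head_le_of_mem hpw D.head hx).trans_lt hl.lt).ne'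
    obtain ⟨τ', hτ', hjτ, -⟩ := D.later y hy hyh
    obtain ⟨h1, h2, h3, τ, hτ, h4, h5, h6⟩ := hl
    refine ⟨by simpa [hs₁, State.setArr_arr] using h1, by simpa [hs₁, State.setArr_arr] using h2,
      h3, τ, by simpa [hs₁, State.setArr_arr, hyh] using hτ, ?_, h5, h6⟩
    rw [hs₁, State.setArr_arr]
    split <;> omega
  refine wp_block ((popBack_spec F hS (s := s₁) (d := d) (j := j) (h := h) (t := t)
    (by simpa [hs₁, State.setArr_arr] using h0) hj ht hw hU D.head D.last
    (fun y hy => ⟨(D.weight_eq y hy).trans hwh, hdj y hy, hwh ▸ D.modEq y hy⟩) hchain₁ ?_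
    (by simp [hs₁, State.setArr_arr]) hlt).mono ?_)
  · intro y hy
    by_cases hyh : y = h
    · exact ⟨j, by simp [hs₁, State.setArr_arr, hyh], le_rfl, hjL⟩
    · obtain ⟨τ, hτ, h1, h2⟩ := D.later y hy hyh
      exact ⟨τ, by simpa [hs₁, State.setArr_arr, hyh] using hτ, h1.le, h2⟩
  rintro n₁ r₁ ⟨d', t', rfl, hpre, hhd', hld', hn₁, hlast, hcov⟩
  have hsub : ∀ z ∈ d', z ∈ d := fun z hz => hpre.subset hz
  have ht'd' : t' ∈ d' := List.mem_of_getLast? hld'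
  have ht'd := hsub t' ht'd'
  have hchain' := hchain₁.prefix hpre
  have hpw' := pairwise_of_isChain_link hchain'
  have hwt' : K.weight t' = K.weight j := (D.weight_eq t' ht'd).trans hwh
  have ht'j := hdj t' ht'd
  obtain ⟨lo, hlo, hjlo, hloL⟩ : ∃ τ : ℕ, s₁.arr 10 t' = τ ∧ j ≤ τ ∧ τ < K.L := by
    by_cases hyh : t' = h
    · exact ⟨j, by simp [hs₁, State.setArr_arr, hyh], le_rfl, hjL⟩
    · obtain ⟨τ, hτ, h1, h2⟩ := D.later t' ht'd hyh
      exact ⟨τ, by simpa [hs₁, State.setArr_arr, hyh] using hτ, h1.le, h2⟩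
  refine wp_block (wp_assign (lo : ℤ) (by simp [Expr.eval, State.setVar_var, State.setVar_arr, hlo])
    ?_)
  refine wp_block (wp_assign (K.L : ℤ) (by
    simp [Expr.eval, State.setVar_var, hs₁, State.setArr_var, hL]) ?_)
  set s₂ := ((s₁.setVar 3 t').setVar 6 lo).setVar 7 K.L with hs₂
  have hv : ∀ x, x ≠ 3 → x < 6 → s₂.var x = s.var x := by
    intro x h3 h6
    rw [hs₂, State.setVar_var, if_neg (by omega), State.setVar_var, if_neg (by omega),
      State.setVar_var, if_neg (by omega), hs₁, State.setArr_var]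
  have hv3 : s₂.var 3 = t' := by simp [hs₂, State.setVar_var]
  have ha₂ : s₂.arr = s₁.arr := rfl
  refine wp_block ((search_spec F (Nat.log 2 K.L + 1) (s := s₂) (j := j) (t := t') (lo := lo)
    (hi := K.L) (by simpa [ha₂, hs₁, State.setArr_arr] using h0)
    ((hv 1 (by omega) (by omega)).trans hj) hv3 ((hv 4 (by omega) (by omega)).trans hw) hU
    (by simp [hs₂, State.setVar_var]) (by simp [hs₂, State.setVar_var]) hwt' ht'j
    (hwh ▸ D.modEq t' ht'd) hjlo hloL le_rfl (hlast lo hlo) (fun hcon => absurd hcon (lt_irrefl _))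
    ((Nat.sub_le _ _).trans (Nat.lt_pow_succ_log_self one_lt_two _).le)).mono ?_)
  rintro n₂ r₂ ⟨hn₂, har₂, hvr₂, τ, h7, hloτ, hτL, hcross⟩
  have hr1 : r₂.var 1 = j := by rw [hvr₂ 1 (by omega), hv 1 (by omega) (by omega), hj]
  have hr3 : r₂.var 3 = t' := by rw [hvr₂ 3 (by omega), hv3]
  have hr0 : r₂.var 0 = K.L := by rw [hvr₂ 0 (by omega), hv 0 (by omega) (by omega), hL]
  have hr4 : r₂.var 4 = K.weight j := by rw [hvr₂ 4 (by omega), hv 4 (by omega) (by omega), hw]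
  refine wp_block (wp_store j t' (by simp [Expr.eval, hr1]) (by simp [Expr.eval, hr3]) ?_)
  refine wp_block (wp_store j τ (by simp [Expr.eval, hr1, State.setArr_var])
    (by simp [Expr.eval, h7, State.setArr_var]) ?_)
  have hjd : j ∉ d := fun hjd => lt_irrefl _ (hdj j hjd)
  -- the links of the part of the queue that is kept survive the changes at `j` and at its end
  have hkeep : ∀ (B : ℕ → ℕ → ℤ), (∀ x, x ≠ j → x ≠ t' → B 8 x = s₁.arr 8 x) →
      (∀ x, x ≠ j → B 9 x = s₁.arr 9 x) → (∀ x, x ≠ j → B 10 x = s₁.arr 10 x) →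
      d'.IsChain (K.Link B) := by
    intro B hB8 hB9 hB10
    refine hchain'.imp_of_mem_imp fun x y hx hy hl => ?_
    have hxj : x ≠ j := fun hxj => hjd (hxj ▸ hsub x hx)
    have hyj : y ≠ j := fun hyj => hjd (hyj ▸ hsub y hy)
    have hxt : x ≠ t' := (hl.lt.trans_le (le_last_of_mem hpw' hld' hy)).ne
    unfold Link at *
    rwa [hB8 x hxj hxt, hB9 y hyj, hB10 y hyj, hB10 x hxj]
  refine wp_cond (if (τ : ℤ) < K.L then 1 else 0) ?_ (fun hne => ?_) (fun hne => ?_)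
  · simp only [Expr.eval, State.setArr_var, h7, hr0, Option.bind_some, F.fit_ite]
  · have hτL' : τ < K.L := by
      by_contra hcon
      exact hne (if_neg (by omega))
    refine wp_block (wp_store t' j (by simp [Expr.eval, hr3, State.setArr_var])
      (by simp [Expr.eval, hr1, State.setArr_var]) ?_)
    refine wp_assign (j : ℤ) (by simp [Expr.eval, hr1, State.setArr_var]) ?_
    refine ⟨d' ++ [j], j, ?_, ?_, by simp [State.setVar_var], ?_, ?_, ?_, ?_, ?_⟩
    · simp [Expr.cost]
      omega
    · intro x hx
      rw [State.setVar_var, if_neg (by omega)]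
      simp only [State.setArr_var]
      rw [hvr₂ x (by omega), hv x (by omega) (by omega)]
    · simp [State.setVar_var, State.setArr_var, hr4]
    · intro a x hax
      simp only [State.setVar_arr, State.setArr_arr, har₂, ha₂, hs₁]
      rw [if_neg, if_neg, if_neg, if_neg] <;>
      · rintro ⟨rfl, rfl⟩
        simp_all
    · constructor
      · rw [List.head?_append, hhd']; rfl
      · simp
      · intro z hz
        rcases List.mem_append.1 hz with hz | hz
        · exact D.weight_eq z (hsub z hz)
        · rw [List.mem_singleton.1 hz, hwh]
      · intro z hz
        rcases List.mem_append.1 hz with hz | hz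
        · exact D.le z (hsub z hz)
        · exact (List.mem_singleton.1 hz).le
      · intro z hz
        rcases List.mem_append.1 hz with hz | hz
        · exact D.modEq z (hsub z hz)
        · rw [List.mem_singleton.1 hz]
      · rw [isChain_concat hld']
        refine ⟨hkeep _ ?_ ?_ ?_, ?_⟩
        · intro x hxj hxt
          simp [State.setVar_arr, State.setArr_arr, har₂, ha₂, hxt]
        · intro x hxj
          simp [State.setVar_arr, State.setArr_arr, har₂, ha₂, hxj]
        · intro x hxj
          simp [State.setVar_arr, State.setArr_arr, har₂, ha₂, hxj]
        · refine ⟨by simp [State.setVar_arr, State.setArr_arr],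
            by simp [State.setVar_arr, State.setArr_arr], ht'j, τ,
            by simp [State.setVar_arr, State.setArr_arr], ?_, hτL', hcross⟩
          simp [State.setVar_arr, State.setArr_arr, har₂, ha₂, ht'j.ne, hlo, hloτ]
      · have : s.arr 8 j = K.L := h8
        simp [State.setVar_arr, State.setArr_arr, har₂, ha₂, hs₁, ht'j.ne', h8]
      · intro z hz hzh
        rcases List.mem_append.1 hz with hz | hz
        · have hzj : z ≠ j := fun hzj => hjd (hzj ▸ hsub z hz)
          simpa [State.setVar_arr, State.setArr_arr, har₂, ha₂, hs₁, hzj, hzh] using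
            D.later z (hsub z hz) hzh
        · refine ⟨τ, ?_, by omega, hτL'⟩
          simp [State.setVar_arr, State.setArr_arr, List.mem_singleton.1 hz]
    · intro z hz
      rcases List.mem_append.1 hz with hz | hz
      · exact .inl (hsub z hz)
      · exact .inr (List.mem_singleton.1 hz)
    · rintro y (hy | rfl) u hju huL
      · rcases hcov y hy u hju huL with h1 | ⟨y', hy', h1⟩
        · exact ⟨j, by simp, h1⟩
        · exact ⟨y', by simp [hy'], h1⟩
      · exact ⟨y, by simp, le_rfl⟩
  · have hτL' : τ = K.L := by
      by_contra hcon
      rw [if_pos (by omega)] at hne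
      exact one_ne_zero hne
    refine wp_store t' K.L (by simp [Expr.eval, hr3, State.setArr_var])
      (by simp [Expr.eval, hr0, State.setArr_var]) ?_
    refine ⟨d', t', ?_, ?_, by simp [State.setArr_var, hr3], ?_, ?_, ?_, ?_, ?_⟩
    · simp [Expr.cost]
      omega
    · intro x hx
      simp only [State.setArr_var]
      rw [hvr₂ x (by omega), hv x (by omega) (by omega)]
    · simp [State.setArr_var, hr4]
    · intro a x hax
      simp only [State.setArr_arr, har₂, ha₂, hs₁]
      rw [if_neg, if_neg, if_neg, if_neg] <;>
      · rintro ⟨rfl, rfl⟩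
        simp_all
    · constructor
      · exact hhd'
      · exact hld'
      · exact fun z hz => D.weight_eq z (hsub z hz)
      · exact fun z hz => D.le z (hsub z hz)
      · exact fun z hz => D.modEq z (hsub z hz)
      · refine hkeep _ ?_ ?_ ?_
        · intro x hxj hxt
          simp [State.setArr_arr, har₂, ha₂, hxt]
        · intro x hxj
          simp [State.setArr_arr, har₂, ha₂, hxj]
        · intro x hxj
          simp [State.setArr_arr, har₂, ha₂, hxj]
      · simp [State.setArr_arr]
      · intro z hz hzh
        have hzj : z ≠ j := fun hzj => hjd (hzj ▸ hsub z hz)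
        simpa [State.setArr_arr, har₂, ha₂, hs₁, hzj, hzh] using D.later z (hsub z hz) hzh
    · exact fun z hz => .inl (hsub z hz)
    · have hjt : ∀ u, j ≤ u → u < K.L → K.val j u ≤ K.val t' u := fun u hju huL =>
        (not_le.1 fun hcon => absurd ((hcross u hju huL).2 hcon) (by omega)).le
      rintro y (hy | rfl) u hju huL
      · rcases hcov y hy u hju huL with h1 | ⟨y', hy', h1⟩
        · exact ⟨t', ht'd', h1.trans (hjt u hju huL)⟩
        · exact ⟨y', hy', h1⟩
      · exact ⟨t', ht'd', hjt u hju huL⟩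

end

/-! ### Passing a queue on -/


/-- The times at which the sources become best increase along the queue. -/
lemma later_of_isChain {A : ℕ → ℕ → ℤ} {i y : ℕ} {d : List ℕ} (hc : (y :: d).IsChain (K.Link A))
    (hy : ∃ τ : ℕ, A 10 y = τ ∧ i < τ ∧ τ < K.L) :
    ∀ z ∈ y :: d, ∃ τ : ℕ, A 10 z = τ ∧ i < τ ∧ τ < K.L := by
  induction d generalizing y with
  | nil =>
    intro z hz
    rwa [List.mem_singleton.1 hz]
  | cons x d ih =>
    rw [List.isChain_cons_cons] at hc
    obtain ⟨⟨-, -, -, τ, hτ, hlt, hτL, -⟩, hc⟩ := hc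
    obtain ⟨σ, hσ, hi, -⟩ := id hy
    intro z hz
    rcases List.mem_cons.1 hz with rfl | hz
    · exact hy
    · exact ih hc ⟨τ, hτ, by omega, hτL⟩ z hz

section
variable {b : ℕ} {M : ℤ} (F : K.Fits b M)
include F

/-- What remains of the queue is as good as before at all times from `i` on, and none of its sources
has been overtaken by its successor at `i`. -/
lemma popFront_spec {d : List ℕ} {s : State} {i h t : ℕ} (hi : s.var 5 = i) (hiL : i < K.L)
    (hh : s.var 2 = h) (hd : d.head? = some h) (hl : d.getLast? = some t)
    (hle : ∀ z ∈ d, z ≤ i) (hc : d.IsChain (K.Link s.arr)) (h8 : s.arr 8 t = K.L)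
    (hsent : s.arr 10 K.L = K.L) :
    wp b K.oracle popFront (fun n r => ∃ (d' : List ℕ) (h' : ℕ), r = s.setVar 2 h' ∧ d' <:+ d ∧
      d'.head? = some h' ∧ d'.getLast? = some t ∧ n + 40 * d'.length ≤ 40 * d.length + 40 ∧
      (∀ z ∈ d', z ≠ h' → ∃ τ : ℕ, s.arr 10 z = τ ∧ i < τ ∧ τ < K.L) ∧
      ∀ y ∈ d, ∀ u, i ≤ u → u < K.L → ∃ y' ∈ d', K.val y u ≤ K.val y' u) s := by
  have hML := F.L_lt
  induction d generalizing s h with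
  | nil => simp at hd
  | cons x d ih =>
    obtain rfl : x = h := by simpa using hd
    cases d with
    | nil =>
      obtain rfl : x = t := by simpa using hl
      refine wp_loop 0 ?_ (fun h => absurd rfl h) fun _ => ?_
      · simp only [Expr.eval, hh, hi, Option.bind_some, Int.natCast_nonneg, if_true, h8,
          Int.toNat_natCast, hsent]
        rw [F.fit 1 (by omega) (by omega), Option.bind_some, F.fit _ (by omega) (by omega),
          Option.bind_some, F.fit_ite, if_neg (by omega)]
      · refine ⟨[x], x, by simp [State.setVar, ← hh], List.suffix_rfl, rfl, rfl, ?_, by simp,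
          fun y hy u _ _ => ⟨y, hy, le_rfl⟩⟩
        simp [Expr.cost]
    | cons y d =>
      have hpw := pairwise_of_isChain_link hc
      have hc' := hc
      rw [List.isChain_cons_cons] at hc'
      obtain ⟨⟨h8x, -, hxy, τ, hτ, -, hτL, hcr⟩, hc'⟩ := hc'
      refine wp_loop (if (τ : ℤ) < i + 1 then 1 else 0) ?_ (fun hne => ?_) (fun hne => ?_)
      · simp only [Expr.eval, hh, hi, Option.bind_some, Int.natCast_nonneg, if_true, h8x,
          Int.toNat_natCast, hτ]
        rw [F.fit 1 (by omega) (by omega), Option.bind_some, F.fit _ (by omega) (by omega),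
          Option.bind_some, F.fit_ite]
      · have hτi : τ ≤ i := by
          by_contra hcon
          exact hne (if_neg (by omega))
        refine wp_assign (y : ℤ) (by simp [Expr.eval, hh, h8x]) ?_
        refine (ih (s := s.setVar 2 y) (h := y) (by simp [State.setVar_var, hi])
          (by simp [State.setVar_var]) rfl (by simpa using hl)
          (fun z hz => hle z (by simp [List.mem_cons.1 hz])) hc' h8 hsent).mono ?_
        rintro n r ⟨d', h', rfl, hsuf, hh', hl', hn, hlat, hcov⟩
        refine ⟨d', h', State.setVar_setVar _ _ _ _, hsuf.trans (List.suffix_cons _ _), hh', hl',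
          ?_, hlat, ?_⟩
        · simp [Expr.cost] at hn ⊢
          omega
        · intro z hz u hiu huL
          rcases List.mem_cons.1 hz with rfl | hz
          · obtain ⟨y', hy', h1⟩ := hcov y (by simp) u hiu huL
            exact ⟨y', hy', ((hcr u ((hle y (by simp)).trans hiu) huL).1 (by omega)).trans h1⟩
          · exact hcov z hz u hiu huL
      · have hτi : i < τ := by
          by_contra hcon
          rw [if_pos (by omega)] at hne
          exact one_ne_zero hne
        refine ⟨x :: y :: d, x, by simp [State.setVar, ← hh], List.suffix_rfl, rfl, hl, ?_, ?_,
          fun y hy u _ _ => ⟨y, hy, le_rfl⟩⟩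
        · simp [Expr.cost]
          omega
        · intro z hz hzx
          have hz : z ∈ y :: d := by simpa [hzx] using hz
          exact later_of_isChain hc' ⟨τ, hτ, hτi, hτL⟩ z hz

/-- The queue is brought to the index `i = j + w`; then either the memory keeps the queue that
waits there, which is at least as good, or the new one is recorded. -/
lemma push_spec (hS : ∀ i, (K.S i).card ≤ 1) {d : List ℕ} {s : State} {j h t : ℕ}
    (h0 : ∀ x < K.L, s.arr 0 x = K.base x) (hh : s.var 2 = h) (ht : s.var 3 = t)
    (hw : s.var 4 = K.weight h) (hU : K.weight h ∈ K.U) (hi : s.var 5 = (j + K.weight h : ℕ))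
    (hiL : j + K.weight h < K.L) (D : K.Deque s.arr j h t d) (hsent : s.arr 10 K.L = K.L)
    (h3l : -(2 * M) < s.arr 3 (j + K.weight h)) (h3u : s.arr 3 (j + K.weight h) < 2 * M)
    (h6l : 0 ≤ s.arr 6 (j + K.weight h)) (h6u : s.arr 6 (j + K.weight h) ≤ K.L) :
    wp b K.oracle push (fun n r => ∃ (d' : List ℕ) (h' : ℕ), K.weight h' = K.weight h ∧
      n + 40 * d'.length ≤ 40 * d.length + 120 ∧ r.var 0 = s.var 0 ∧ r.var 1 = s.var 1 ∧
      K.Deque s.arr (j + K.weight h) h' t d' ∧ d' <:+ d ∧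
      (∀ y ∈ d, ∀ u, j + K.weight h ≤ u → u < K.L → ∃ y' ∈ d', K.val y u ≤ K.val y' u) ∧
      ((r.arr = s.arr ∧ s.arr 6 (j + K.weight h) ≠ 0 ∧
          K.val h' (j + K.weight h) ≤ s.arr 3 (j + K.weight h)) ∨
        ((s.arr 6 (j + K.weight h) = 0 ∨
            s.arr 3 (j + K.weight h) < K.val h' (j + K.weight h)) ∧
          r.arr 6 (j + K.weight h) = h' + 1 ∧ r.arr 7 (j + K.weight h) = t ∧
          r.arr 3 (j + K.weight h) = K.val h' (j + K.weight h) ∧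
          ∀ a x, (a ≠ 3 ∧ a ≠ 6 ∧ a ≠ 7) ∨ x ≠ j + K.weight h → r.arr a x = s.arr a x))) s := by
  have hML := F.L_lt
  obtain ⟨i, hi'⟩ : ∃ i, i = j + K.weight h := ⟨_, rfl⟩
  rw [← hi'] at hi hiL h3l h3u h6l h6u ⊢
  refine wp_block ((popFront_spec F (i := i) hi hiL hh D.head D.last
    (fun z hz => (D.le z hz).trans (by omega)) D.chain D.next hsent).mono ?_)
  rintro n₁ r₁ ⟨d', h', rfl, hsuf, hh', hl', hn₁, hlat, hcov⟩
  have hh'd : h' ∈ d := hsuf.subset (List.mem_of_head? hh')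
  have hwh' : K.weight h' = K.weight h := D.weight_eq h' hh'd
  have hh'i : h' ≤ i := (D.le h' hh'd).trans (by omega)
  have hvb := F.val_bound hS h' hiL
  have D' : K.Deque s.arr i h' t d' := by
    refine ⟨hh', hl', fun z hz => (D.weight_eq z (hsuf.subset hz)).trans hwh'.symm,
      fun z hz => (D.le z (hsuf.subset hz)).trans (by omega), fun z hz => ?_,
      D.chain.suffix hsuf, D.next, hlat⟩
    rw [hwh', hi']
    exact (D.modEq z (hsuf.subset hz)).trans (by simp [Nat.ModEq])
  have e1 := F.eval_valExpr (s := s.setVar 2 h') (z := .var 2) (u := .var 5) (zv := h') (uv := i)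
    h0 (hwh' ▸ hU) (by simp [State.setVar_var, hw, hwh']) (by simp [Expr.eval, State.setVar_var])
    (by simp [Expr.eval, State.setVar_var, hi]) hh'i hiL
  refine wp_block (wp_assign (K.val h' i) e1 ?_)
  refine wp_cond ((if K.val h' i < s.arr 3 i + 1 then 1 else 0) * s.arr 6 i) ?_
    (fun hne => ?_) (fun hne => ?_)
  · have hv9 : ((s.setVar 2 h').setVar 9 (K.val h' i)).var 9 = K.val h' i := by
      simp [State.setVar_var]
    have hv5 : ((s.setVar 2 h').setVar 9 (K.val h' i)).var 5 = i := by
      simp [State.setVar_var, hi]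
    simp only [Expr.eval, hv9, hv5, State.setVar_arr, Option.bind_some, Int.natCast_nonneg,
      if_true, Int.toNat_natCast]
    rw [F.fit 1 (by omega) (by omega), Option.bind_some, F.fit _ (by omega) (by omega),
      Option.bind_some, F.fit_ite, Option.bind_some]
    split
    · rw [one_mul]; exact F.fit _ (by omega) (by omega)
    · rw [zero_mul]; exact F.fit _ (by omega) (by omega)
  · have hle : K.val h' i ≤ s.arr 3 i := by
      by_contra hcon
      exact hne (by rw [if_neg (by omega), zero_mul])
    refine wp_skip ⟨d', h', hwh', ?_, rfl, rfl, D', hsuf, hcov, .inl ⟨rfl, ?_, hle⟩⟩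
    · simp [Expr.cost, valExpr]
      omega
    · exact right_ne_zero_of_mul hne
  · refine wp_block (wp_store i (h' + 1 : ℕ) (by simp [Expr.eval, State.setVar_var, hi]) ?_ ?_)
    · simp only [Expr.eval, State.setVar_var]
      rw [F.fit 1 (by omega) (by omega)]
      simp
      exact F.fit _ (by omega) (by omega)
    refine wp_block (wp_store i t (by simp [Expr.eval, State.setVar_var, State.setArr_var, hi])
      (by simp [Expr.eval, State.setVar_var, State.setArr_var, ht]) ?_)
    refine wp_store i (K.val h' i)
      (by simp [Expr.eval, State.setVar_var, State.setArr_var, hi])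
      (by simp [Expr.eval, State.setVar_var, State.setArr_var]) ?_
    refine ⟨d', h', hwh', ?_, rfl, rfl, D', hsuf, hcov, .inr ⟨?_, ?_, ?_, ?_, ?_⟩⟩
    · simp [Expr.cost, valExpr]
      omega
    · rcases mul_eq_zero.1 hne with hne | hne
      · right
        by_contra hcon
        rw [if_pos (by omega)] at hne
        exact one_ne_zero hne
      · exact .inl hne
    · simp [State.setArr_arr]
    · simp [State.setArr_arr]
    · simp [State.setArr_arr]
    · intro a x hax
      simp only [State.setArr_arr, State.setVar_arr]
      rw [if_neg, if_neg, if_neg] <;>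
      · rintro ⟨rfl, rfl⟩
        simp at hax

end

/-! ### The invariant of the sweep -/

/-- The queue `d` waits at the index `p` when the sweep is at the index `j`. As `p` is the first
index of the progression of its sources that is at least `j`, no two waiting queues have the same
weight and residue. -/
structure Pending (K : KnapsackExtendWeak) (A : ℕ → ℕ → ℤ) (j p h t : ℕ) (d : List ℕ) : Prop
    extends K.Deque A p h t d where
  weight_ne : K.weight h ≠ 0
  ge : j ≤ p
  lt_add : p < j + K.weight h
  lt_L : p < K.L
  head_eq : A 6 p = h + 1
  last_eq : A 7 p = t
  val_eq : A 3 p = K.val h p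
  lt : ∀ z ∈ d, z < j

/-- The output for the index `p` is the solution with the starting point `z`, and it is not worse
than the empty solution or any source before `p` that wins at `p`. -/
structure Final (K : KnapsackExtendWeak) (A : ℕ → ℕ → ℤ) (p z : ℕ) : Prop where
  le : z ≤ p
  modEq : z ≡ p [MOD K.weight z]
  start_eq : A 2 p = z
  val_eq : A 3 p = K.val z p
  weight_eq : A 4 p = K.weight z
  mult_eq : A 5 p = ((p - z) / K.weight z : ℕ)
  base_le : K.base p ≤ K.val z p
  val_le : ∀ y < p, K.Wins y p → K.val y p ≤ K.val z p

/-- The invariant of the sweep at the index `j`, where the queue `D p` waits at the index `p` (the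
empty list if there is none). The essential part is `wins`: if some source before `j` wins at `i`,
then so does one that is still in a queue. -/
structure Inv (K : KnapsackExtendWeak) (j : ℕ) (s : State) (D : ℕ → List ℕ) : Prop where
  var_zero : s.var 0 = K.L
  var_one : s.var 1 = j
  le : j ≤ K.L
  base : ∀ x < K.L, s.arr 0 x = K.base x
  weight : ∀ x < K.L, s.arr 1 x = K.weight x
  sentinel : s.arr 10 K.L = K.L
  none : ∀ p, j ≤ p → p < K.L → D p = [] → s.arr 6 p = 0 ∧ s.arr 3 p = 0
  some : ∀ p, D p ≠ [] → ∃ h t, K.Pending s.arr j p h t (D p)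
  wins : ∀ i y, j ≤ i → y < j → K.Wins y i → ∃ p, ∃ y' ∈ D p, K.Wins y' i
  final : ∀ p < j, ∃ z, K.Final s.arr p z

section
variable {b : ℕ} {M : ℤ} (F : K.Fits b M)
include F

/-- At the index `j`, the queue `d` that goes on is headed by the best offer at `j`, and contains a
winner for every later index at which the old queue or `j` itself has one. -/
lemma choose_spec (hS : ∀ i, (K.S i).card ≤ 1) {D : ℕ → List ℕ} {s : State} {j : ℕ}
    (I : K.Inv j s D) (hjL : j < K.L) :
    wp b K.oracle choose (fun n r => ∃ (d : List ℕ) (h t : ℕ),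
      n + 40 * d.length ≤ 40 * (D j).length + 60 * (Nat.log 2 K.L + 1) + 250 ∧
      r.var 0 = K.L ∧ r.var 1 = j ∧ r.var 2 = h ∧ r.var 3 = t ∧ r.var 4 = K.weight h ∧
      K.Deque r.arr j h t d ∧ (∀ z ∈ d, z ∈ D j ∨ z = j) ∧
      (∀ a x, (a < 8 ∧ a ≠ 3) ∨ 10 < a ∨ (x ≠ j ∧ x ∉ D j) → r.arr a x = s.arr a x) ∧
      (∀ x, x ≠ j → r.arr 3 x = s.arr 3 x) ∧
      r.arr 3 j = K.val h j ∧ K.base j ≤ K.val h j ∧ (∀ y ∈ D j, K.val y j ≤ K.val h j) ∧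
      ∀ i y, j < i → y ∈ D j ∨ y = j → K.Wins y i → ∃ y' ∈ d, K.Wins y' i) s := by
  have hML := F.L_lt
  have hj := I.var_one
  refine wp_block (wp_store j K.L (by simp [Expr.eval, hj]) (by simp [Expr.eval, I.var_zero]) ?_)
  set s₁ := s.setArr 8 j K.L with hs₁
  have hj₁ : s₁.var 1 = j := hj
  have ha₁ : ∀ a x, a ≠ 8 → s₁.arr a x = s.arr a x := by
    intro a x ha
    simp [hs₁, State.setArr_arr, ha]
  have h6b : 0 ≤ s.arr 6 j ∧ s.arr 6 j ≤ K.L := by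
    by_cases hD : D j = []
    · rw [(I.none j le_rfl hjL hD).1]; omega
    · obtain ⟨h, t, P⟩ := I.some j hD
      have := P.lt h P.toDeque.head_mem
      rw [P.head_eq]; omega
  -- the product is nonzero if and only if a queue waits at `j` and is better than `j` itself
  refine wp_cond ((if K.base j < s.arr 3 j then 1 else 0) * s.arr 6 j) ?_
    (fun hne => ?_) (fun hne => ?_)
  · simp only [Expr.eval, hj₁, Option.bind_some, Int.natCast_nonneg, if_true, Int.toNat_natCast,
      ha₁ 0 j (by omega), ha₁ 3 j (by omega), ha₁ 6 j (by omega), I.base j hjL, F.fit_ite]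
    split
    · rw [one_mul]; exact F.fit _ (by omega) (by omega)
    · rw [zero_mul]; exact F.fit _ (by omega) (by omega)
  · have hlt : K.base j < s.arr 3 j := by
      by_contra hcon
      exact hne (by rw [if_neg hcon, zero_mul])
    have hD : D j ≠ [] := fun hD => right_ne_zero_of_mul hne (I.none j le_rfl hjL hD).1
    obtain ⟨h, t, P⟩ := I.some j hD
    rw [P.val_eq] at hlt
    have hjD : j ∉ D j := fun hjD => lt_irrefl _ (P.lt j hjD)
    have hhj := P.lt h P.toDeque.head_mem
    refine wp_block (wp_assign (h : ℤ) ?_ ?_)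
    · simp only [Expr.eval, hj₁, Option.bind_some, Int.natCast_nonneg, if_true,
        Int.toNat_natCast, ha₁ 6 j (by omega), P.head_eq]
      rw [F.fit 1 (by omega) (by omega), Option.bind_some, add_sub_cancel_right]
      exact F.fit _ (by omega) (by omega)
    refine wp_block (wp_assign (t : ℤ) (by
      simp [Expr.eval, State.setVar_var, State.setVar_arr, hj₁, ha₁, P.last_eq]) ?_)
    refine wp_block (wp_assign (K.weight h : ℤ) (by
      simp [Expr.eval, State.setVar_var, State.setVar_arr, ha₁, I.weight h (by omega)]) ?_)
    set s₂ := ((s₁.setVar 2 h).setVar 3 t).setVar 4 (K.weight h) with hs₂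
    have ha₂ : s₂.arr = s₁.arr := rfl
    have hD₂ : K.Deque s₂.arr j h t (D j) := by
      refine P.toDeque.congr (fun z hz => ?_) (fun z hz => ?_) (fun z hz => ?_)
      · simp [ha₂, hs₁, State.setArr_arr, (P.lt z hz).ne]
      · simp [ha₂, hs₁, State.setArr_arr]
      · simp [ha₂, hs₁, State.setArr_arr]
    have hframe : ∀ a x, a ≠ 8 ∨ x ≠ j → s₂.arr a x = s.arr a x := by
      intro a x hax
      rw [ha₂, hs₁, State.setArr_arr, if_neg]
      rintro ⟨rfl, rfl⟩
      simp at hax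
    have hv0 : s₂.var 0 = K.L := by simp [hs₂, State.setVar_var, hs₁, State.setArr_var, I.var_zero]
    have hv1 : s₂.var 1 = j := by simp [hs₂, State.setVar_var, hs₁, State.setArr_var, hj]
    have hv2 : s₂.var 2 = h := by simp [hs₂, State.setVar_var]
    have hv3 : s₂.var 3 = t := by simp [hs₂, State.setVar_var]
    have hv4 : s₂.var 4 = K.weight h := by simp [hs₂, State.setVar_var]
    refine wp_cond (if (K.weight h : ℤ) = K.weight j then 1 else 0) ?_
      (fun hne => ?_) (fun hne => ?_)
    · simp only [Expr.eval, hv1, hv4, Option.bind_some, Int.natCast_nonneg, if_true,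
        Int.toNat_natCast, hframe 1 j (by omega), I.weight j hjL, F.fit_ite]
    · have hw : K.weight h = K.weight j := by
        by_contra hcon
        exact hne (if_neg (by omega))
      refine (append_spec F hS (fun x hx => (hframe 0 x (by omega)).trans (I.base x hx)) hv0 hv1 hv2
        hv3 (hw ▸ hv4) (hw ▸ weight_mem hS P.weight_ne) hD₂ hw P.lt
        (by simp [ha₂, hs₁, State.setArr_arr]) hjL hlt).mono ?_
      rintro n r ⟨d', t', hn, hvr, hr3, hr4, har, hD', hsub, hcov⟩
      refine ⟨d', h, t', ?_, (hvr 0 (by omega)).trans hv0, (hvr 1 (by omega)).trans hv1,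
        (hvr 2 (by omega)).trans hv2, hr3, hw ▸ hr4, hD', hsub, ?_, ?_, ?_, hlt.le,
        fun y hy => P.toDeque.val_le_head hjL hy, ?_⟩
      · simp [Expr.cost]
        omega
      · intro a x hax
        clear hne
        rw [har a x (by tauto), hframe a x (by omega)]
      · intro x hx
        rw [har 3 x (by omega), hframe 3 x (by omega)]
      · rw [har 3 j (by omega), hframe 3 j (by omega), P.val_eq]
      · intro i y hji hy hwin
        obtain ⟨y', hy', hle⟩ := hcov y hy i hji.le hwin.lt_right
        have hwy : K.weight y = K.weight h := by
          rcases hy with hy | rfl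
          · exact P.weight_eq y hy
          · exact hw.symm
        refine ⟨y', hy', hwin.of_val_le hS ((hD'.le y' hy').trans hji.le)
          (by rw [hD'.weight_eq y' hy']; exact P.weight_ne) ?_ hle⟩
        rw [hD'.weight_eq y' hy']
        have hyj : y ≡ j [MOD K.weight h] := by
          rcases hy with hy | rfl
          · exact P.modEq y hy
          · exact Nat.ModEq.refl _
        exact (hD'.modEq y' hy').trans (hyj.symm.trans (hwy ▸ hwin.modEq hS))
    · have hw : K.weight h ≠ K.weight j := by
        intro hcon
        rw [if_pos (by omega)] at hne
        exact one_ne_zero hne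
      refine wp_skip ⟨D j, h, t, ?_, hv0, hv1, hv2, hv3, hv4, hD₂, fun z hz => .inl hz, ?_, ?_, ?_,
        hlt.le, fun y hy => P.toDeque.val_le_head hjL hy, ?_⟩
      · simp [Expr.cost]
        omega
      · exact fun a x hax => hframe a x (by omega)
      · exact fun x hx => hframe 3 x (by omega)
      · rw [hframe 3 j (by omega), P.val_eq]
      · rintro i y hji (hy | rfl) hwin
        · exact ⟨y, hy, hwin⟩
        · have := hwin.val_lt_of_weight_ne hS le_rfl hji (Nat.ModEq.refl _) hhj P.weight_ne
            (P.modEq h P.toDeque.head_mem) hw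
          rw [val_self hS] at this
          omega
  · have hle : ∀ y ∈ D j, K.val y j ≤ K.base j := by
      intro y hy
      obtain ⟨h, t, P⟩ := I.some j (List.ne_nil_of_mem hy)
      refine (P.toDeque.val_le_head hjL hy).trans ?_
      rw [← P.val_eq]
      by_contra hcon
      rw [if_pos (by omega), P.head_eq] at hne
      omega
    refine wp_block (wp_assign (j : ℤ) (by simp [Expr.eval, hj₁]) ?_)
    refine wp_block (wp_assign (j : ℤ) (by simp [Expr.eval, hj₁, State.setVar_var]) ?_)
    refine wp_block (wp_assign (K.weight j : ℤ) (by
      simp [Expr.eval, hj₁, State.setVar_var, State.setVar_arr, ha₁, I.weight j hjL]) ?_)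
    refine wp_store j (K.base j) (by simp [Expr.eval, hj₁, State.setVar_var]) (by
      simp [Expr.eval, hj₁, State.setVar_var, State.setVar_arr, ha₁, I.base j hjL]) ?_
    rw [← val_self hS] at hle
    refine ⟨[j], j, j, ?_, ?_, ?_, ?_, ?_, ?_, .singleton ?_, by simp, ?_, ?_, ?_,
      (val_self hS).ge, hle, ?_⟩
    · simp only [Expr.cost, List.length_singleton]
      omega
    · simp [State.setArr_var, State.setVar_var, hs₁, I.var_zero]
    · simp [State.setArr_var, State.setVar_var, hs₁, hj]
    · simp [State.setArr_var, State.setVar_var]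
    · simp [State.setArr_var, State.setVar_var]
    · simp [State.setArr_var, State.setVar_var]
    · simp [State.setArr_arr, State.setVar_arr, hs₁]
    · intro a x hax
      simp only [State.setArr_arr, State.setVar_arr, hs₁]
      rw [if_neg, if_neg] <;>
      · rintro ⟨rfl, rfl⟩
        simp at hax
    · intro x hx
      simp [State.setArr_arr, State.setVar_arr, hs₁, hx]
    · simp [State.setArr_arr, val_self hS]
    · rintro i y hji (hy | rfl) hwin
      · obtain ⟨h, t, P⟩ := I.some j (List.ne_nil_of_mem hy)
        refine ⟨j, by simp, hwin.of_val_le_base hS (P.lt y hy).le hji ?_ ?_⟩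
        · rw [P.weight_eq y hy]
          exact P.modEq y hy
        · rw [← val_self hS]
          exact hle y hy
      · exact ⟨y, by simp, hwin⟩

end

/-! ### One step of the sweep -/


lemma eq_of_modEq_of_window {a c j w : ℕ} (h : a ≡ c [MOD w]) (ha : j ≤ a) (ha' : a < j + w)
    (hc : j ≤ c) (hc' : c < j + w) : a = c := by
  rcases le_total a c with hac | hac
  · have := Nat.eq_zero_of_dvd_of_lt ((Nat.modEq_iff_dvd' hac).1 h) (by omega)
    omega
  · have := Nat.eq_zero_of_dvd_of_lt ((Nat.modEq_iff_dvd' hac).1 h.symm) (by omega)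
    omega

lemma add_le_of_modEq {j i w : ℕ} (h : j ≡ i [MOD w]) (hji : j < i) : j + w ≤ i := by
  have := Nat.le_of_dvd (by omega) ((Nat.modEq_iff_dvd' hji.le).1 h)
  omega

lemma profit_single_val (hS : ∀ i, (K.S i).card ≤ 1) (z : Fin K.L) (i : ℕ) :
    K.profit z (Finsupp.single (K.weight z) ((i - z) / K.weight z)) = K.val z i := by
  by_cases hw : K.weight z = 0
  · simp [hw, profit_zero, val, base_fin]
  · exact profit_single_weight (weight_mem hS hw)

lemma Wins.val_le {y z i : ℕ} (hS : ∀ i, (K.S i).card ≤ 1) (h : K.Wins y i) (h' : K.Wins z i) :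
    K.val y i ≤ K.val z i := by
  have ⟨hy, hi, _, _, hm⟩ := h
  have ⟨hz, _, _, _, hm'⟩ := h'
  have := hm'.2 _ _ hm.1
  rwa [profit_single_val hS ⟨y, hy⟩, profit_single_val hS ⟨z, hz⟩] at this

/-- When two queues of different weights meet at the index `i`, the one with the better head may
replace the other. A source of the other queue can win only at `i` itself, where the better
head wins, too; for a later index this would contradict the promise. -/
lemma Deque.wins_of_le {A B : ℕ → ℕ → ℤ} {i h₁ t₁ h₂ t₂ z k : ℕ} {d₁ d₂ : List ℕ}
    (hS : ∀ i, (K.S i).card ≤ 1) (X : K.Deque A i h₁ t₁ d₁) (Y : K.Deque B i h₂ t₂ d₂)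
    (hw : K.weight h₂ ≠ 0) (hne : K.weight h₂ ≠ K.weight h₁) (h₂i : h₂ < i)
    (hle : K.val h₁ i ≤ K.val h₂ i) (hz : z ∈ d₁) (hwin : K.Wins z k) (hik : i ≤ k) :
    K.Wins h₂ k := by
  have hzi := (X.val_le_head (hik.trans_lt hwin.lt_right) hz).trans hle
  have hmod := Y.modEq h₂ Y.head_mem
  rcases hik.eq_or_lt with rfl | hik
  · exact hwin.of_val_le hS h₂i.le hw hmod hzi
  · have := hwin.val_lt_of_weight_ne hS (X.le z hz) hik
      (by rw [X.weight_eq z hz]; exact X.modEq z hz) h₂i hw hmod (by rwa [X.weight_eq z hz])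
    omega

/-- Waiting queues at different indices are disjoint. -/
lemma Inv.eq_of_mem {j p : ℕ} {s : State} {D : ℕ → List ℕ} (I : K.Inv j s D)
    {z : ℕ} (hz : z ∈ D p) (hzj : z ∈ D j) : p = j := by
  obtain ⟨h, t, P⟩ := I.some p (List.ne_nil_of_mem hz)
  obtain ⟨h', t', P'⟩ := I.some j (List.ne_nil_of_mem hzj)
  have hw : K.weight h' = K.weight h := (P'.weight_eq z hzj).symm.trans (P.weight_eq z hz)
  refine eq_of_modEq_of_window (w := K.weight h) (j := j)
    ((P.modEq z hz).symm.trans (hw ▸ P'.modEq z hzj)) P.ge P.lt_add le_rfl ?_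
  have := P.weight_ne
  omega

/-- The part of the step that does not depend on what happens to the queue at `j`. -/
lemma Inv.step {j : ℕ} {s r : State} {D D' : ℕ → List ℕ} (I : K.Inv j s D) (hjL : j < K.L)
    (hv0 : r.var 0 = K.L) (hv1 : r.var 1 = (j + 1 : ℕ))
    (h01 : ∀ a x, a < 2 → r.arr a x = s.arr a x)
    (hlist : ∀ a x, 8 ≤ a → x ≠ j → x ∉ D j → r.arr a x = s.arr a x) (hDj : D' j = [])
    (hD' : ∀ p, p ≠ j → (D' p = D p ∧ ∀ a < 8, r.arr a p = s.arr a p) ∨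
      (j < p ∧ ∃ h t, K.Pending r.arr (j + 1) p h t (D' p)))
    (hwins : ∀ i y, j < i → (∃ p, y ∈ D p) ∨ y = j → K.Wins y i →
      ∃ p, ∃ y' ∈ D' p, K.Wins y' i)
    (hfin : ∃ z, K.Final r.arr j z) : K.Inv (j + 1) r D' where
  var_zero := hv0
  var_one := hv1
  le := hjL
  base x hx := (h01 0 x (by omega)).trans (I.base x hx)
  weight x hx := (h01 1 x (by omega)).trans (I.weight x hx)
  sentinel := by
    rw [hlist 10 K.L (by omega) hjL.ne', I.sentinel]
    intro hmem
    obtain ⟨h, t, P⟩ := I.some j (List.ne_nil_of_mem hmem)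
    exact absurd (P.lt _ hmem) (by omega)
  none p hp hpL hnil := by
    rcases hD' p (by omega) with ⟨hD, ha⟩ | ⟨-, h, t, P⟩
    · rw [ha 6 (by omega), ha 3 (by omega)]
      exact I.none p (by omega) hpL (hD ▸ hnil)
    · exact absurd P.toDeque.head_mem (by simp [hnil])
  some p hp := by
    have hpj : p ≠ j := fun hpj => hp (hpj ▸ hDj)
    rcases hD' p hpj with ⟨hD, ha⟩ | ⟨-, h, t, P⟩
    · rw [hD] at hp ⊢
      obtain ⟨h, t, P⟩ := I.some p hp
      have hmem : ∀ a z, 8 ≤ a → z ∈ D p → r.arr a z = s.arr a z := fun a z h8 hz =>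
        hlist a z h8 (P.lt z hz).ne fun hzj => hpj (I.eq_of_mem hz hzj)
      exact ⟨h, t, P.toDeque.congr (fun z => hmem 8 z (by omega)) (fun z => hmem 9 z (by omega))
        (fun z => hmem 10 z (by omega)), P.weight_ne, by have := P.ge; omega,
        by have := P.lt_add; omega, P.lt_L, (ha 6 (by omega)).trans P.head_eq,
        (ha 7 (by omega)).trans P.last_eq, (ha 3 (by omega)).trans P.val_eq,
        fun z hz => (P.lt z hz).trans (by omega)⟩
    · exact ⟨h, t, P⟩
  wins i y hi hy hwin := by
    by_cases hyj : y = j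
    · exact hwins i y hi (.inr hyj) hwin
    · obtain ⟨p, y', hy', hwin'⟩ := I.wins i y (by omega) (by omega) hwin
      exact hwins i y' hi (.inl ⟨p, hy'⟩) hwin'
  final p hp := by
    by_cases hpj : p = j
    · exact hpj ▸ hfin
    · rcases hD' p hpj with ⟨-, ha⟩ | ⟨hjp, -⟩
      · obtain ⟨z, P⟩ := I.final p (by omega)
        exact ⟨z, P.le, P.modEq, (ha 2 (by omega)).trans P.start_eq,
          (ha 3 (by omega)).trans P.val_eq, (ha 4 (by omega)).trans P.weight_eq,
          (ha 5 (by omega)).trans P.mult_eq, P.base_le, P.val_le⟩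
      · omega

/-- The number of sources in the waiting queues: the potential that pays for the removals. -/
def potential (K : KnapsackExtendWeak) (D : ℕ → List ℕ) : ℕ := ∑ p ∈ Finset.range K.L, (D p).length

lemma potential_update (D : ℕ → List ℕ) {p : ℕ} (hp : p < K.L) (d : List ℕ) :
    K.potential (Function.update D p d) + (D p).length = K.potential D + d.length := by
  unfold potential
  have hmem := Finset.mem_range.2 hp
  rw [← Finset.add_sum_erase _ _ hmem, ← Finset.add_sum_erase _ (fun p => (D p).length) hmem,
    Finset.sum_congr rfl (g := fun p => (D p).length) (fun x hx => by
      rw [Function.update_of_ne (Finset.ne_of_mem_erase hx)])]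
  simp
  omega

lemma Inv.final_of_head {j h t : ℕ} {s r : State} {D : ℕ → List ℕ} {d : List ℕ}
    (hS : ∀ i, (K.S i).card ≤ 1) (I : K.Inv j s D) {A : ℕ → ℕ → ℤ} (X : K.Deque A j h t d)
    (h2 : r.arr 2 j = h) (h3 : r.arr 3 j = K.val h j)
    (h4 : r.arr 4 j = K.weight h) (h5 : r.arr 5 j = ((j - h) / K.weight h : ℕ))
    (hbase : K.base j ≤ K.val h j) (hval : ∀ y ∈ D j, K.val y j ≤ K.val h j) :
    K.Final r.arr j h where
  le := X.le h X.head_mem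
  modEq := X.modEq h X.head_mem
  start_eq := h2
  val_eq := h3
  weight_eq := h4
  mult_eq := h5
  base_le := hbase
  val_le y hy hwin := by
    obtain ⟨p, y', hy', hwin'⟩ := I.wins j y le_rfl hy hwin
    obtain ⟨h', t', P⟩ := I.some p (List.ne_nil_of_mem hy')
    have hpj : p = j := by
      refine eq_of_modEq_of_window (w := K.weight h') (j := j)
        ((P.modEq y' hy').symm.trans ?_) P.ge P.lt_add le_rfl ?_
      · rw [← P.weight_eq y' hy']
        exact hwin'.modEq hS
      · have := P.weight_ne
        omega
    exact (hwin.val_le hS hwin').trans (hval y' (hpj ▸ hy'))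

section
variable {b : ℕ} {M : ℤ} (F : K.Fits b M)
include F

/-- The potential pays 40 steps for each removal. -/
lemma body_spec (hS : ∀ i, (K.S i).card ≤ 1) {D : ℕ → List ℕ} {s : State} {j : ℕ}
    (I : K.Inv j s D) (hjL : j < K.L) :
    wp b K.oracle body (fun n r => ∃ D' : ℕ → List ℕ,
      n + 40 * K.potential D' ≤ 40 * K.potential D + 60 * (Nat.log 2 K.L + 1) + 500 ∧
      K.Inv (j + 1) r D') s := by
  have hML := F.L_lt
  refine wp_block ((choose_spec F hS I hjL).mono ?_)
  rintro n₁ r₁ ⟨d, h, t, hn₁, hv0, hv1, hv2, hv3, hv4, X, hdsub, har, har3, h3, hbase, hval,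
    hwins⟩
  have hhj : h ≤ j := X.le h X.head_mem
  have hpot := potential_update D hjL ([] : List ℕ)
  simp only [List.length_nil] at hpot
  refine wp_block (wp_store j h (by simp [Expr.eval, hv1]) (by simp [Expr.eval, hv2]) ?_)
  refine wp_block (wp_store j (K.weight h) (by simp [Expr.eval, State.setArr_var, hv1])
    (by simp [Expr.eval, State.setArr_var, hv4]) ?_)
  set r₂ := (r₁.setArr 2 j h).setArr 4 j (K.weight h) with hr₂
  have hv : r₂.var = r₁.var := rfl
  have hinc : ∀ r : State, r.var 1 = j →
      (Expr.inc (.var 1)).eval b K.oracle r = some ((j + 1 : ℕ) : ℤ) := by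
    intro r hr
    simp only [Expr.eval, hr, Option.bind_some]
    rw [F.fit 1 (by omega) (by omega), Option.bind_some, F.fit _ (by omega) (by omega)]
    simp
  -- the wins that pass through `j` are passed on to the next index of the progression
  have hnext : ∀ i y, j < i → y ∈ D j ∨ y = j → K.Wins y i →
      K.weight h ≠ 0 ∧ j + K.weight h ≤ i ∧ ∃ y' ∈ d, K.Wins y' i := by
    intro i y hi hy hwin
    obtain ⟨y', hy', hwin'⟩ := hwins i y hi hy hwin
    have hw := X.weight_eq y' hy'
    refine ⟨hw ▸ hwin'.weight_ne, add_le_of_modEq ?_ hi, y', hy', hwin'⟩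
    exact (X.modEq y' hy').symm.trans (hw ▸ hwin'.modEq hS)
  -- if the queue is not passed on, those at the other indices stay as they are
  have hdrop : ∀ r : State, r.var 0 = K.L → r.var 1 = (j + 1 : ℕ) →
      (∀ a x, a ≠ 5 ∨ x ≠ j → r.arr a x = r₂.arr a x) →
      r.arr 5 j = ((j - h) / K.weight h : ℕ) →
      (∀ i y, j < i → y ∈ D j ∨ y = j → K.Wins y i → ∃ p, p ≠ j ∧ ∃ y' ∈ D p, K.Wins y' i) →
      K.Inv (j + 1) r (Function.update D j []) := by
    intro r h0 h1 ha h5 hw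
    have ha' : ∀ a x, a ≠ 2 ∧ a ≠ 4 ∧ a ≠ 5 ∨ x ≠ j → r.arr a x = r₁.arr a x := by
      intro a x hax
      rw [ha a x (by tauto), hr₂, State.setArr_arr, State.setArr_arr, if_neg (by tauto),
        if_neg (by tauto)]
    refine I.step hjL h0 h1 ?_ ?_ (by simp) ?_ ?_ ⟨h, I.final_of_head hS X ?_ ?_ ?_ h5 hbase hval⟩
    · intro a x hax
      rw [ha' a x (by omega), har a x (by omega)]
    · intro a x hax hxj hxD
      rw [ha' a x (by omega), har a x (by tauto)]
    · intro p hp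
      refine .inl ⟨by simp [hp], fun a hax => ?_⟩
      rw [ha' a p (by omega)]
      by_cases h3 : a = 3
      · exact h3 ▸ har3 p hp
      · exact har a p (by omega)
    · rintro i y hi hy hwin
      by_cases hyj : y ∈ D j ∨ y = j
      · obtain ⟨p, hp, y', hy', hwin'⟩ := hw i y hi hyj hwin
        exact ⟨p, y', by simpa [hp] using hy', hwin'⟩
      · obtain ⟨p, hp⟩ : ∃ p, y ∈ D p := by tauto
        have hpj : p ≠ j := by
          rintro rfl
          tauto
        exact ⟨p, y, by simpa [hpj] using hp, hwin⟩
    · rw [ha 2 j (by omega)]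
      simp [hr₂, State.setArr_arr]
    · rw [ha' 3 j (by omega), h3]
    · rw [ha 4 j (by omega)]
      simp [hr₂, State.setArr_arr]
  refine wp_block (wp_cond (K.weight h : ℤ) (by simp [Expr.eval, hv, hv4]) (fun hne => ?_)
    (fun hne => ?_))
  · have hw : K.weight h ≠ 0 := by exact_mod_cast hne
    have hU := weight_mem hS hw
    have hwM := F.weight_lt _ hU
    have hdiv := Nat.div_le_self (j - h) (K.weight h)
    obtain ⟨m, hm⟩ : ∃ m, m = (j - h) / K.weight h := ⟨_, rfl⟩
    rw [← hm] at hdiv hdrop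
    refine wp_block (wp_store j m (by simp [Expr.eval, hv, hv1]) ?_ ?_)
    · simp only [Expr.eval, hv, hv1, hv2, hv4, Option.bind_some]
      rw [F.fit _ (by omega) (by omega), Option.bind_some, if_neg hne,
        ← Int.natCast_sub hhj, ← Int.natCast_div, ← hm, F.fit _ (by omega) (by omega)]
    set r₃ := r₂.setArr 5 j m with hr₃
    have hv₃ : r₃.var = r₁.var := rfl
    refine wp_block (wp_assign ((j + K.weight h : ℕ) : ℤ) ?_ ?_)
    · simp only [Expr.eval, hv₃, hv1, hv4, Option.bind_some]
      rw [F.fit _ (by omega) (by omega)]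
      simp
    set r₄ := r₃.setVar 5 (j + K.weight h : ℕ) with hr₄
    have hv₄ : ∀ x, x ≠ 5 → r₄.var x = r₁.var x := by
      intro x hx
      rw [hr₄, State.setVar_var, if_neg hx, hv₃]
    have hv5 : r₄.var 5 = (j + K.weight h : ℕ) := by simp [hr₄, State.setVar_var]
    have har₄ : ∀ a x, a ≠ 5 ∨ x ≠ j → r₄.arr a x = r₂.arr a x := by
      intro a x hax
      rw [hr₄, State.setVar_arr, hr₃, State.setArr_arr, if_neg (by tauto)]
    have har5 : r₄.arr 5 j = m := by
      simp [hr₄, State.setVar_arr, hr₃, State.setArr_arr]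
    have har₄' : ∀ a x, a ≠ 2 ∧ a ≠ 4 ∧ a ≠ 5 ∨ x ≠ j → r₄.arr a x = r₁.arr a x := by
      intro a x hax
      rw [har₄ a x (by tauto), hr₂, State.setArr_arr, State.setArr_arr, if_neg (by tauto),
        if_neg (by tauto)]
    refine wp_cond (if ((j + K.weight h : ℕ) : ℤ) < K.L then 1 else 0) ?_ (fun hne => ?_)
      (fun hne => ?_)
    · simp only [Expr.eval, hv5, hv₄ 0 (by omega), hv0, Option.bind_some, F.fit_ite]
    · have hiL : j + K.weight h < K.L := by
        by_contra hcon
        exact hne (if_neg (by omega))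
      have hij : j + K.weight h ≠ j := by omega
      have hs3 : r₄.arr 3 (j + K.weight h) = s.arr 3 (j + K.weight h) := by
        rw [har₄' 3 _ (by omega), har3 _ hij]
      have hs6 : r₄.arr 6 (j + K.weight h) = s.arr 6 (j + K.weight h) := by
        rw [har₄' 6 _ (by omega), har 6 _ (by omega)]
      have hbound : (-(2 * M) < s.arr 3 (j + K.weight h) ∧ s.arr 3 (j + K.weight h) < 2 * M) ∧
          0 ≤ s.arr 6 (j + K.weight h) ∧ s.arr 6 (j + K.weight h) ≤ K.L := by
        by_cases hD : D (j + K.weight h) = []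
        · have := I.none _ (by omega) hiL hD
          omega
        · obtain ⟨h', t', P⟩ := I.some _ hD
          rw [P.val_eq, P.head_eq]
          have := P.lt h' P.toDeque.head_mem
          exact ⟨F.val_bound hS h' hiL, by omega, by omega⟩
      have X₄ : K.Deque r₄.arr j h t d := X.congr (fun z _ => har₄' 8 z (by omega))
        (fun z _ => har₄' 9 z (by omega)) (fun z _ => har₄' 10 z (by omega))
      have hLD : K.L ∉ D j := by
        intro hmem
        obtain ⟨h, t, P⟩ := I.some j (List.ne_nil_of_mem hmem)
        exact absurd (P.lt _ hmem) (by omega)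
      refine (push_spec F hS (s := r₄) (j := j) (h := h) (t := t) (d := d) ?_
        ((hv₄ 2 (by omega)).trans hv2)
        ((hv₄ 3 (by omega)).trans hv3) ((hv₄ 4 (by omega)).trans hv4) hU hv5 hiL X₄ ?_
        (by rw [hs3]; exact hbound.1.1) (by rw [hs3]; exact hbound.1.2)
        (by rw [hs6]; exact hbound.2.1) (by rw [hs6]; exact hbound.2.2)).mono ?_
      · intro x hx
        rw [har₄' 0 x (by omega), har 0 x (by omega), I.base x hx]
      · rw [har₄' 10 _ (by omega), har 10 _ (.inr (.inr ⟨hjL.ne', hLD⟩)), I.sentinel]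
      rintro n₂ r₅ ⟨d', h', hwh', hn₂, hv0', hv1', Y, hsuf, hcov, hcase⟩
      rw [hs3, hs6] at hcase
      have hv1'' : r₅.var 1 = j := by rw [hv1', hv₄ 1 (by omega), hv1]
      have hv0'' : r₅.var 0 = K.L := by rw [hv0', hv₄ 0 (by omega), hv0]
      have hh'i : ∀ z ∈ d', z < j + K.weight h := fun z hz =>
        (X.le z (hsuf.subset hz)).trans_lt (by omega)
      have hwin' : ∀ i y, j < i → y ∈ D j ∨ y = j → K.Wins y i →
          j + K.weight h ≤ i ∧ ∃ y' ∈ d', K.Wins y' i := by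
        intro i y hi hy hwin
        obtain ⟨-, hle, y', hy', hwin'⟩ := hnext i y hi hy hwin
        obtain ⟨y'', hy'', hval'⟩ := hcov y' hy' i hle hwin.lt_right
        refine ⟨hle, y'', hy'', hwin'.of_val_le hS ((hh'i y'' hy'').le.trans hle)
          (by rw [Y.weight_eq y'' hy'', hwh']; exact hw) ?_ hval'⟩
        rw [Y.weight_eq y'' hy'', hwh']
        have h1 := X.modEq y'' (hsuf.subset hy'')
        have h2 := X.modEq y' hy'
        have h3 := hwin'.modEq hS
        rw [X.weight_eq y' hy'] at h3
        exact h1.trans (h2.symm.trans h3)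
      -- a queue already waiting at the next index has a different weight, as it was put there
      -- from an index before `j`
      have hother : ∀ h₂ t₂, K.Pending s.arr j (j + K.weight h) h₂ t₂ (D (j + K.weight h)) →
          K.weight h₂ ≠ K.weight h' := by
        intro h₂ t₂ P
        have := P.lt_add
        omega
      refine wp_assign _ (hinc r₅ hv1'') ?_
      rcases hcase with ⟨hr₅, h6, hle⟩ | ⟨hlt, h6, h7, h3', har₅⟩
      · refine ⟨Function.update D j [], ?_, hdrop _ ?_ ?_ ?_ ?_ ?_⟩
        · simp [Expr.cost]
          omega
        · simp [State.setVar_var, hv0'']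
        · simp [State.setVar_var]
        · intro a x hax
          rw [State.setVar_arr, hr₅, har₄ a x hax]
        · rw [State.setVar_arr, hr₅, har5]
        · intro i y hi hy hwin
          have hD : D (j + K.weight h) ≠ [] := fun hD => h6 (I.none _ (by omega) hiL hD).1
          obtain ⟨h₂, t₂, P⟩ := I.some _ hD
          obtain ⟨hle', y', hy', hwin''⟩ := hwin' i y hi hy hwin
          rw [P.val_eq] at hle
          exact ⟨j + K.weight h, hij, h₂, P.toDeque.head_mem,
            Y.wins_of_le hS P.toDeque P.weight_ne (hother h₂ t₂ P)
              ((P.lt h₂ P.toDeque.head_mem).trans (by omega)) hle hy' hwin'' hle'⟩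
      · have hpot' := potential_update (Function.update D j []) hiL d'
        refine ⟨Function.update (Function.update D j []) (j + K.weight h) d', ?_,
          I.step hjL ?_ ?_ ?_ ?_ ?_ ?_ ?_ ⟨h, I.final_of_head hS X ?_ ?_ ?_ ?_ hbase hval⟩⟩
        · simp [Expr.cost]
          omega
        · simp [State.setVar_var, hv0'']
        · simp [State.setVar_var]
        · intro a x hax
          rw [State.setVar_arr, har₅ a x (by omega), har₄' a x (by omega), har a x (by omega)]
        · intro a x hax hxj hxD
          rw [State.setVar_arr, har₅ a x (by omega), har₄' a x (by omega), har a x (by tauto)]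
        · simp [Function.update_of_ne hij.symm]
        · intro p hp
          by_cases hpi : p = j + K.weight h
          · rw [hpi]
            refine .inr ⟨by omega, h', t, ?_⟩
            rw [Function.update_self]
            have Y₅ : K.Deque r₅.arr (j + K.weight h) h' t d' := Y.congr
              (fun z _ => har₅ 8 z (by omega)) (fun z _ => har₅ 9 z (by omega))
              (fun z _ => har₅ 10 z (by omega))
            exact ⟨Y₅, by rw [hwh']; exact hw, by omega, by omega, hiL, h6, h7, h3',
              fun z hz => Nat.lt_succ_of_le (X.le z (hsuf.subset hz))⟩
          · refine .inl ⟨by simp [hp, hpi], fun a hax => ?_⟩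
            rw [State.setVar_arr, har₅ a p (.inr hpi), har₄' a p (.inr hp)]
            by_cases h3 : a = 3
            · exact h3 ▸ har3 p hp
            · exact har a p (by omega)
        · intro i y hi hy hwin
          by_cases hyj : y ∈ D j ∨ y = j
          · obtain ⟨-, y', hy', hwin''⟩ := hwin' i y hi hyj hwin
            exact ⟨j + K.weight h, y', by simpa using hy', hwin''⟩
          · obtain ⟨p, hp⟩ : ∃ p, y ∈ D p := by tauto
            have hpj : p ≠ j := by
              rintro rfl
              tauto
            by_cases hpi : p = j + K.weight h
            · subst hpi
              obtain ⟨h₂, t₂, P⟩ := I.some _ (List.ne_nil_of_mem hp)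
              rw [P.val_eq, P.head_eq] at hlt
              have hik : j + K.weight h ≤ i := by
                by_contra hcon
                have hyi := hwin.modEq hS
                rw [P.weight_eq y hp] at hyi
                have hmod := (P.modEq y hp).symm.trans hyi
                have := P.lt_add
                have := eq_of_modEq_of_window hmod P.ge P.lt_add hi.le (by omega)
                omega
              exact ⟨j + K.weight h, h', by simpa using Y.head_mem,
                P.toDeque.wins_of_le hS Y (by rw [hwh']; exact hw) (hother h₂ t₂ P).symm
                  (hh'i h' Y.head_mem) (by omega) hp hwin hik⟩
            · exact ⟨p, y, by simpa [hpj, hpi] using hp, hwin⟩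
        · rw [State.setVar_arr, har₅ 2 j (by omega), har₄ 2 j (by omega)]
          simp [hr₂, State.setArr_arr]
        · rw [State.setVar_arr, har₅ 3 j (by omega), har₄' 3 j (by omega), h3]
        · rw [State.setVar_arr, har₅ 4 j (by omega), har₄ 4 j (by omega)]
          simp [hr₂, State.setArr_arr]
        · rw [State.setVar_arr, har₅ 5 j (by omega), har5, hm]
    · have hiL : K.L ≤ j + K.weight h := by
        by_contra hcon
        rw [if_pos (by omega)] at hne
        exact one_ne_zero hne
      refine wp_skip (wp_assign _ (hinc r₄ ((hv₄ 1 (by omega)).trans hv1)) ?_)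
      refine ⟨Function.update D j [], ?_, hdrop _ ?_ ?_ ?_ ?_ ?_⟩
      · simp [Expr.cost]
        omega
      · simp [State.setVar_var, hv₄, hv0]
      · simp [State.setVar_var]
      · exact fun a x hax => har₄ a x hax
      · exact har5
      · intro i y hi hy hwin
        have := (hnext i y hi hy hwin).2.1
        have := hwin.lt_right
        omega
  · have hw : K.weight h = 0 := by exact_mod_cast hne
    refine wp_store j 0 (by simp [Expr.eval, hv, hv1]) ?_ ?_
    · rw [Expr.eval, F.fit _ (by omega) (by omega)]
    refine wp_assign _ (hinc _ (by simp [State.setArr_var, hv, hv1])) ?_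
    refine ⟨Function.update D j [], ?_, hdrop _ ?_ ?_ ?_ ?_ ?_⟩
    · simp [Expr.cost]
      omega
    · simp [State.setVar_var, State.setArr_var, hv, hv0]
    · simp [State.setVar_var]
    · intro a x hax
      rw [State.setVar_arr, State.setArr_arr, if_neg (by tauto)]
    · simp [State.setVar_arr, State.setArr_arr, hw]
    · intro i y hi hy hwin
      exact absurd hw (hnext i y hi hy hwin).1

lemma sweep_spec (hS : ∀ i, (K.S i).card ≤ 1) (k : ℕ) {D : ℕ → List ℕ} {s : State} {j : ℕ}
    (I : K.Inv j s D) (hk : j + k = K.L) :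
    wp b K.oracle (.loop (.lt (.var 1) (.var 0)) body) (fun n r =>
      n ≤ 40 * K.potential D + k * (60 * (Nat.log 2 K.L + 1) + 510) + 10 ∧
      ∃ D', K.Inv K.L r D') s := by
  induction k generalizing D s j with
  | zero =>
    refine wp_loop 0 ?_ (fun h => absurd rfl h) fun _ => ⟨?_, D, ?_⟩
    · simp only [Expr.eval, I.var_zero, I.var_one, Option.bind_some]
      rw [F.fit_ite, if_neg (by omega)]
    · simp only [Expr.cost]
      omega
    · obtain rfl : j = K.L := by omega
      exact I
  | succ k ih =>
    refine wp_loop 1 ?_ (fun _ => ?_) (fun h => absurd h one_ne_zero)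
    · simp only [Expr.eval, I.var_zero, I.var_one, Option.bind_some]
      rw [F.fit_ite, if_pos (by omega)]
    · refine (body_spec F hS I (by omega)).mono ?_
      rintro n r ⟨D', hn, I'⟩
      refine (ih I' (by omega)).mono ?_
      rintro n' r' ⟨hn', h⟩
      refine ⟨?_, h⟩
      simp only [Expr.cost]
      rw [Nat.add_mul]
      omega

lemma program_spec (hS : ∀ i, (K.S i).card ≤ 1) :
    wp b K.oracle program (fun n r =>
      n ≤ K.L * (60 * (Nat.log 2 K.L + 1) + 510) + 15 ∧ ∃ D, K.Inv K.L r D) K.input := by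
  refine wp_block (wp_store K.L K.L (by simp [Expr.eval, input]) (by simp [Expr.eval, input]) ?_)
  have I : K.Inv 0 (K.input.setArr 10 K.L K.L) (fun _ => []) := by
    refine ⟨by simp [State.setArr_var, input], by simp [State.setArr_var, input], by omega,
      fun x hx => ?_, fun x hx => ?_, by simp [State.setArr_arr], fun p _ hp _ => ?_,
      fun p hp => absurd rfl hp, fun i y _ hy => absurd hy (by omega),
      fun p hp => absurd hp (by omega)⟩
    · simp [State.setArr_arr, input, hx, base]
    · simp [State.setArr_arr, input, hx, weight]
    · simp [State.setArr_arr, input]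
  refine (sweep_spec F hS K.L I (by omega)).mono ?_
  rintro n r ⟨hn, h⟩
  refine ⟨?_, h⟩
  simp [potential, Expr.cost] at hn ⊢
  omega

end

/-! ### The output and the running time -/

lemma exists_isMaximizer (i : Fin K.L) : ∃ y v, K.IsMaximizer i y v := by
  have hfin : {p : Fin K.L × (ℕ →₀ ℕ) | K.IsSolution i p.1 p.2}.Finite := by
    refine ((Set.finite_univ (α := Fin K.L)).prod
      (Set.finite_Iic (Finsupp.indicator K.U fun _ _ => K.L))).subset ?_
    rintro ⟨y, v⟩ ⟨hv, hsum⟩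
    refine ⟨trivial, fun w => ?_⟩
    by_cases hw : w ∈ K.U
    · rw [Finsupp.indicator_of_mem hw]
      have h1 := Finset.single_le_sum (f := fun w => w * v w) (fun _ _ => Nat.zero_le _) hw
      have h2 := Nat.le_mul_of_pos_left (v w) (pos_of_mem hw)
      have h3 := i.2
      simp only at h1 hsum h2 ⊢
      omega
    · have : v w = 0 := Finsupp.notMem_support_iff.1 fun h => hw (hv h)
      simp [this]
  obtain ⟨⟨y, v⟩, hs, hmax⟩ := Set.exists_max_image _ (fun p => K.profit p.1 p.2) hfin
    ⟨(i, 0), by simp [IsSolution]⟩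
  exact ⟨y, v, hs, fun y' v' h => hmax (y', v') h⟩

lemma Final.isMaximizer {A : ℕ → ℕ → ℤ} {i : Fin K.L} {z : ℕ} (hS : ∀ i, (K.S i).card ≤ 1)
    (P : K.Final A i z) (hz : z < K.L)
    (hsol : K.IsSolution i ⟨z, hz⟩ (Finsupp.single (K.weight z) ((i - z) / K.weight z)))
    (hweak : K.IsWeak i) :
    K.IsMaximizer i ⟨z, hz⟩ (Finsupp.single (K.weight z) ((i - z) / K.weight z)) := by
  obtain ⟨y, v, hm⟩ := exists_isMaximizer i
  refine ⟨hsol, fun y' v' h' => (hm.2 y' v' h').trans ?_⟩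
  rw [profit_single_val hS ⟨z, hz⟩]
  have hsupp := hweak y v hm
  by_cases hv : v = 0
  · subst hv
    have hyi : y = i := Fin.ext (by simpa using hm.1.2)
    rw [profit_zero, hyi, ← base_fin]
    exact P.base_le
  · obtain ⟨w, hw⟩ := Finsupp.support_nonempty_iff.2 hv
    have hwy := weight_eq_of_mem hS (hsupp hw)
    have hwU := K.S_subset _ (hsupp hw)
    have hpos := pos_of_mem hwU
    have hvs : v = Finsupp.single w (v w) := by
      ext u
      by_cases hu : u = w
      · simp [hu]
      · rw [Finsupp.single_eq_of_ne hu]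
        by_contra hne
        exact hu ((weight_eq_of_mem hS (hsupp (Finsupp.mem_support_iff.2 hne))).symm.trans hwy)
    have hsum := hm.1.2
    rw [hvs, Finset.sum_eq_single w (fun u _ hu => by simp [Finsupp.single_eq_of_ne hu])
      (fun h => absurd hwU h), Finsupp.single_eq_same] at hsum
    have hdiv : (i - y : ℕ) / K.weight y = v w := by
      rw [hwy, show (i - y : ℕ) = w * v w by omega, Nat.mul_div_cancel_left _ hpos]
    have hvw : 0 < w * v w :=
      Nat.mul_pos hpos (Nat.pos_of_ne_zero (Finsupp.mem_support_iff.1 hw))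
    have hveq : v = Finsupp.single (K.weight y) ((i - y : ℕ) / K.weight y) := by
      rw [hdiv, hwy]; exact hvs
    have hwin : K.Wins y i :=
      ⟨y.2, i.2, by rw [hwy]; exact hpos.ne', hweak, by rw [← hveq]; exact hm⟩
    rw [hveq, profit_single_val hS y]
    exact P.val_le y (by omega) hwin

lemma Inv.isOutput {s : State} {D : ℕ → List ℕ} (hS : ∀ i, (K.S i).card ≤ 1)
    (I : K.Inv K.L s D) : K.IsOutput s := by
  choose z P using fun i : Fin K.L => I.final i i.2
  have hz : ∀ i, z i < K.L := fun i => (P i).le.trans_lt i.2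
  have hsol : ∀ i, K.IsSolution i ⟨z i, hz i⟩
      (Finsupp.single (K.weight (z i)) ((i - z i) / K.weight (z i))) := by
    intro i
    refine isSolution_single ?_ (add_mul_div_of_modEq (P i).le (P i).modEq)
    by_cases hw : K.weight (z i) = 0
    · exact .inr (by simp [hw])
    · exact .inl (weight_mem hS hw)
  refine ⟨fun i => Finsupp.single (K.weight (z i)) ((i - z i) / K.weight (z i)),
    fun i => ⟨z i, hz i⟩, fun i => K.val (z i) i, fun i => ⟨hsol i, ?_, ?_⟩, fun i => ?_⟩
  · exact (profit_single_val hS ⟨z i, hz i⟩ i).symm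
  · exact fun hweak => (P i).isMaximizer hS (hz i) (hsol i) hweak
  · exact ⟨(P i).start_eq, (P i).val_eq, _, _, (P i).weight_eq, (P i).mult_eq, rfl⟩

lemma isBigO_running_time :
    (fun L : ℕ => ((L * (60 * (Nat.log 2 L + 1) + 510) + 15 : ℕ) : ℝ)) =O[Filter.atTop]
      (fun L : ℕ => (L : ℝ) * Real.log (L : ℝ)) := by
  refine Asymptotics.IsBigO.of_bound 2000 ?_
  filter_upwards [Filter.eventually_ge_atTop 3] with L hL
  have hL' : (3 : ℝ) ≤ L := by exact_mod_cast hL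
  have hlog : 1 ≤ Real.log L := by
    rw [Real.le_log_iff_exp_le (by linarith)]
    exact Real.exp_one_lt_d9.le.trans (by linarith)
  have hnat : (Nat.log 2 L : ℝ) ≤ 2 * Real.log L := by
    have h1 : ((2 : ℝ) ^ Nat.log 2 L) ≤ L := by
      exact_mod_cast Nat.pow_log_le_self 2 (by omega)
    have h2 := Real.log_le_log (by positivity) h1
    rw [Real.log_pow] at h2
    have h3 := Real.log_two_gt_d9
    have h4 : (0 : ℝ) ≤ Nat.log 2 L := by positivity
    nlinarith
  rw [Real.norm_of_nonneg (by positivity), Real.norm_of_nonneg (by positivity)]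
  push_cast
  have hpos : (0 : ℝ) ≤ L := by linarith
  have h1 : (L : ℝ) * (60 * (Nat.log 2 L + 1) + 510) ≤ L * (690 * Real.log L) := by
    gcongr
    linarith
  have h2 : (15 : ℝ) ≤ L * (15 * Real.log L) := by nlinarith
  nlinarith

end KnapsackExtendWeak

theorem mainTheorem8 :
    ∃ (P : WordRAM.Cmd) (c : ℕ) (T : ℕ → ℕ),
      (fun L : ℕ => (T L : ℝ)) =O[Filter.atTop] (fun L : ℕ => (L : ℝ) * Real.log (L : ℝ)) ∧
      ∀ (K : KnapsackExtendWeak) (W : ℕ), (∀ i, (K.S i).card ≤ 1) → K.FitsIn W →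
        ∃ (t : ℕ) (s : WordRAM.State),
          WordRAM.Exec (W + c) K.oracle P K.input t s ∧ t ≤ T K.L ∧ K.IsOutput s := by
  refine ⟨KnapsackExtendWeak.program, 5, fun L => L * (60 * (Nat.log 2 L + 1) + 510) + 15,
    KnapsackExtendWeak.isBigO_running_time, fun K W hS hW => ?_⟩
  obtain ⟨t, s, hexec, ht, D, I⟩ := KnapsackExtendWeak.program_spec hW.fits hS
  exact ⟨t, s, hexec, ht, I.isOutput hS⟩
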